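/- Let $m\ge 1$ and let $k$ be a commutative Noetherian ring. Let $\mathcal C$ be the skeleton of $\mathrm{FI}^m$: its objects are $\mathbf n=(n_1,\dots,n_m)\in\mathbb N^m$, with degree $\deg(\mathbf n)=n_1+\dots+n_m$, and a morphism $\mathbf n\to\mathbf t$ is an $m$-tuple of injections $[n_i]\to[t_i]$. A $\mathcal C$-module is a functor $V:\mathcal C\to k\text{-}\mathrm{Mod}$. Definitions. * $V$ is finitely generated if finitely many elements of its values generate it. With $(H_0(V))_{\mathbf n}$ the quotient of $V_{\mathbf n}$ by the span of the images of all $V_{\mathbf t}\to V_{\mathbf n}$ induced by morphisms $\mathbf t\to\mathbf n$ with $\mathbf t\ne\mathbf n$, put $\mathrm{gd}(V)=\sup\{\deg(\mathbf n): (H_0(V))_{\mathbf n}\neq 0\}$, and $\mathrm{gd}(V)=-1$ if this set is empty. * $V$ is basic relative projective if it is isomorphic to $k\mathcal C(\mathbf n,-)\otimes_{kS_{\mathbf n}}W$ for some object $\mathbf n$ and some module $W$ over the group algebra of $S_{\mathbf n}=\mathrm{End}(\mathbf n)\cong S_{n_1}\times\dots\times S_{n_m}$. $V$ is relative projective if it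 has a finite filtration $0=V^{0}\subseteq V^{1}\subseteq\dots\subseteq V^{s}=V$ whose factors are basic relative projective. * $v\in V_{\mathbf n}$ is torsion if $f\cdot v=0$ for some morphism $f$ out of $\mathbf n$. $V$ is torsion if it is generated by its torsion elements. * The functor $\iota_i:\mathcal C\to\mathcal C$ adds $1$ to the $i$-th coordinate of an object. On morphisms it replaces $f_i$ by the injection $1\mapsto 1$, $t+1\mapsto f_i(t)+1$, and keeps the other components. Put $\Sigma_iV=V\circ\iota_i$, let $V\to\Sigma_iV$ be the natural map induced by $t\mapsto t+1$ in the $i$-th coordinate, and let $K_iV$ be its kernel. Put $\mathrm{td}_i(V)=\sup\{n_i:(K_iV)_{\mathbf n}\ne0\}$, and $\mathrm{td}_i(V)=-1$ if this set is empty. **Theorem 1.4.** Let $V$ be a finitely generated $\mathcal C$-module over $k$. There are an integer $l\ge -1$ and a complex of finitely generated $\mathcal C$-modules $$F^\bullet:\quad 0\to V\to F^0\to F^1\to\dots\to F^l\to 0,$$ with $V$ placed in degree $-1$ ($l=-1$ meaning the complex $0\to V\to 0$), such that 1. each $F^j$, $0\le j\le l$, is relative projective with $\mathrm{gd}(F^j)\le\mathrm{gd}(V)-j$;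 2. $l\le\mathrm{gd}(V)$; 3. all cohomology modules $H^j(F^\bullet)$, $-1\le j\le l$, including $H^{-1}(F^\bullet)=\ker(V\to F^0)$, are finitely generated torsion modules. Moreover, for every complex $F^\bullet$ of $\mathcal C$-modules of this shape with properties (1)–(3), and for all $n_1,\dots,n_m\in\mathbb N$ with $n_i\ge\mathrm{td}_i(H^j(F^\bullet))+1$ for all $-1\le j\le l$ and all $1\le i\le m$, the module $\Sigma_1^{n_1}\cdots\Sigma_m^{n_m}V$ is relative projective. -/

import Mathlib

open CategoryTheory CategoryTheory.Limits

universe u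

noncomputable section

namespace FIm

/-- Objects of the skeleton of the category `FI`: the number `n` stands for the finite set `[n]`,
modelled by `Fin n`. -/
structure FI : Type where
  /-- The number of elements of the finite set. -/
  size : ℕ

/-- Morphisms of the skeleton of `FI` are the injections `[a] → [b]`. -/
instance : Category.{0} FI where
  Hom a b := Fin a.size ↪ Fin b.size
  id a := Function.Embedding.refl _
  comp f g := f.trans g

/-- A morphism of `FI`, as an injection of finite sets. -/
def FI.toEmb {a b : FI} (f : a ⟶ b) : Fin a.size ↪ Fin b.size := f

/-- The skeleton `𝒞` of the product category `FI^m`: objects are `m`-tuples, and morphisms are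
`m`-tuples of injections (the product category of Mathlib). -/
abbrev Cat (m : ℕ) : Type := Fin m → FI

/-- The `i`-th entry `n_i` of an object `n` of `𝒞`. -/
def size {m : ℕ} (n : Cat m) (i : Fin m) : ℕ := (n i).size

/-- The degree `n_1 + ⋯ + n_m` of an object. -/
def deg {m : ℕ} (n : Cat m) : ℕ := ∑ i, size n i

/-- `𝒞`-modules over `k`: covariant functors from `𝒞` to `k`-modules. -/
abbrev Mod (m : ℕ) (k : Type u) [CommRing k] := Cat m ⥤ ModuleCat.{u} k

/-! ### Shift functors -/

/-- The self-embedding of `FI`. It sends `[n]` to `[n+1]` and an injection `f` to the injection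
that fixes the first element and is `t + 1 ↦ f t + 1` on the others. -/
def succFI : FI ⥤ FI where
  obj a := ⟨a.size + 1⟩
  map {a b} f := (
    { toFun := Fin.cases 0 (fun t => (FI.toEmb f t).succ)
      inj' := by
        intro x y
        refine Fin.cases ?_ (fun x => ?_) x <;> refine Fin.cases ?_ (fun y => ?_) y
        · simp
        · intro h
          exact absurd h.symm (Fin.succ_ne_zero _)
        · intro h
          exact absurd h (Fin.succ_ne_zero _)
        · intro h
          exact congrArg Fin.succ ((FI.toEmb f).injective (Fin.succ_injective _ h)) } :
      Fin (a.size + 1) ↪ Fin (b.size + 1))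
  map_id a := by
    apply Function.Embedding.ext
    intro x
    refine Fin.cases ?_ (fun x => ?_) x <;> rfl
  map_comp f g := by
    apply Function.Embedding.ext
    intro x
    refine Fin.cases ?_ (fun x => ?_) x <;> rfl

/-- The natural inclusions `[n] → [n+1]`, `t ↦ t + 1`. -/
def succPi : 𝟭 FI ⟶ succFI where
  app a := Fin.succEmb a.size
  naturality _ _ _ := rfl

/-- The self-embedding `succFI` of `FI` if the flag is set, the identity functor otherwise. -/
def condSucc : Bool → (FI ⥤ FI)
  | true => succFI
  | false => 𝟭 FI

/-- The natural map from the identity functor to `condSucc b`. -/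
def condPi : (b : Bool) → (𝟭 FI ⟶ condSucc b)
  | true => succPi
  | false => 𝟙 _

/-- The `i`-th self-embedding functor of `𝒞`: it is the self-embedding of `FI` in the
coordinate `i`, and the identity in all other coordinates. -/
def iota {m : ℕ} (i : Fin m) : Cat m ⥤ Cat m :=
  Functor.pi (fun j => condSucc (decide (j = i)))

/-- The natural transformation from the identity functor to the `i`-th self-embedding: it is
`t ↦ t + 1` in the coordinate `i`, and the identity in all other coordinates. -/
def piNat {m : ℕ} (i : Fin m) : 𝟭 (Cat m) ⟶ iota i where
  app n j := (condPi (decide (j = i))).app (n j)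
  naturality a b f := by
    funext j
    exact (condPi (decide (j = i))).naturality (f j)

section modules

variable {m : ℕ} {k : Type u} [CommRing k]

/-- The `i`-th shift functor `Σ_i`, pull-back along the `i`-th self-embedding. -/
def shift (i : Fin m) : Mod.{u} m k ⥤ Mod.{u} m k :=
  (Functor.whiskeringLeft _ _ _).obj (iota i)

/-- The iterated shift `Σ_1^{n_1} ⋯ Σ_m^{n_m} V`. -/
def multiShift (n : Fin m → ℕ) (V : Mod.{u} m k) : Mod.{u} m k :=
  (List.finRange m).foldr (fun i W => (shift i).obj^[n i] W) V

/-! ### Generation and the generating degree -/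

/-- The value at `n` of the submodule of `V` generated by a family `S` of elements of `V`
(an element of `V` being an object together with an element of the value there). -/
def generated (V : Mod.{u} m k) (S : Set (Σ t : Cat m, V.obj t)) (n : Cat m) :
    Submodule k (V.obj n) :=
  Submodule.span k {y | ∃ x ∈ S, ∃ f : x.1 ⟶ n, (V.map f).hom x.2 = y}

/-- `V` is finitely generated: some finite set of elements generates `V`. -/
def FinGen (V : Mod.{u} m k) : Prop :=
  ∃ S : Set (Σ t : Cat m, V.obj t), S.Finite ∧ ∀ n, generated V S n = ⊤

/-- The value at `n` of `𝔪 V`, where `𝔪` is the ideal of the category algebra spanned by the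
morphisms `t → n` with `t < n` (as soon as a morphism `t → n` exists, one has `t ≤ n`, so that
`t < n` just means `t ≠ n`). -/
def augSub (V : Mod.{u} m k) (n : Cat m) : Submodule k (V.obj n) :=
  Submodule.span k {y | ∃ (t : Cat m) (f : t ⟶ n) (v : V.obj t), t ≠ n ∧ (V.map f).hom v = y}

/-- The value at `n` of the zeroth homology `H_0(V) = (k𝒞/𝔪) ⊗ V = V / 𝔪 V`. -/
abbrev H0 (V : Mod.{u} m k) (n : Cat m) : Type u := V.obj n ⧸ augSub V n

/-- The supremum of a set of natural numbers, with value `-1` on the empty set and `∞` on an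
unbounded set. -/
def supDeg (S : Set ℕ) : EReal :=
  sSup (insert (-1) ((fun s : ℕ => (s : EReal)) '' S))

/-- The generating degree `gd(V) = sup {deg n | H_0(V)_n ≠ 0}`. -/
def gd (V : Mod.{u} m k) : EReal :=
  supDeg {d | ∃ n : Cat m, Nontrivial (H0 V n) ∧ deg n = d}

/-! ### Torsion -/

/-- `v ∈ V_n` is a torsion element: some morphism out of `n` kills it. -/
def IsTorsionElt (V : Mod.{u} m k) {n : Cat m} (v : V.obj n) : Prop :=
  ∃ (t : Cat m) (f : n ⟶ t), (V.map f).hom v = 0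

/-- `V` is a torsion module: the submodule generated by its torsion elements is all of `V`. -/
def IsTorsion (V : Mod.{u} m k) : Prop :=
  ∀ n, generated V {x | IsTorsionElt V x.2} n = ⊤

/-- The value at `n` of `K_i V`, the kernel of the natural map `V → Σ_i V`. -/
def Ksub (i : Fin m) (V : Mod.{u} m k) (n : Cat m) : Submodule k (V.obj n) :=
  LinearMap.ker (V.map ((piNat i).app n)).hom

/-- The `i`-th torsion degree `td_i(V) = sup {n_i | (K_i V)_n ≠ 0}`. -/
def td (i : Fin m) (V : Mod.{u} m k) : EReal :=
  supDeg {s | ∃ n : Cat m, Ksub i V n ≠ ⊥ ∧ size n i = s}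

/-! ### Relative projective modules -/

/-- The relations of the tensor product over the group algebra of `S_n = End n`, namely
`f σ ⊗ w = f ⊗ σ w`, inside `k𝒞(n, t) ⊗_k W`, which is written as the module of finitely
supported functions `𝒞(n, t) → W`, with `f ⊗ w` as `Finsupp.single f w`. -/
def tensorRel (n : Cat m) {W : Type u} [AddCommGroup W] [Module k W]
    (ρ : Representation k (End n) W) (t : Cat m) : Submodule k ((n ⟶ t) →₀ W) :=
  Submodule.span k {y | ∃ (f : n ⟶ t) (σ : End n) (x : W),
    Finsupp.single (σ ≫ f) x - Finsupp.single f (ρ σ x) = y}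

/-- Postcomposition with `g`, that is `f ⊗ x ↦ g f ⊗ x`, before dividing by the relations. -/
def postcomp (n : Cat m) (W : Type u) [AddCommGroup W] [Module k W] {t t' : Cat m} (g : t ⟶ t') :
    ((n ⟶ t) →₀ W) →ₗ[k] ((n ⟶ t') →₀ W) :=
  Finsupp.lmapDomain W k (fun f => f ≫ g)

theorem tensorRel_le (n : Cat m) {W : Type u} [AddCommGroup W] [Module k W]
    (ρ : Representation k (End n) W) {t t' : Cat m} (g : t ⟶ t') :
    tensorRel n ρ t ≤ (tensorRel n ρ t').comap (postcomp (k := k) n W g) := by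
  refine Submodule.span_le.2 ?_
  rintro y ⟨f, σ, x, rfl⟩
  refine Submodule.subset_span ⟨f ≫ g, σ, x, ?_⟩
  simp [postcomp, Finsupp.lmapDomain_apply, sub_eq_add_neg, Finsupp.mapDomain_add,
    ← Finsupp.single_neg, Finsupp.mapDomain_single]

/-- The basic relative projective module `M(n) ⊗_{k S_n} W` of a `k S_n`-module `W`. -/
def basic (n : Cat m) {W : Type u} [AddCommGroup W] [Module k W]
    (ρ : Representation k (End n) W) : Mod.{u} m k where
  obj t := ModuleCat.of k (((n ⟶ t) →₀ W) ⧸ tensorRel n ρ t)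
  map g := ModuleCat.ofHom (Submodule.mapQ _ _ (postcomp n W g) (tensorRel_le n ρ g))
  map_id t := by
    refine ModuleCat.hom_ext (LinearMap.ext fun x => ?_)
    obtain ⟨x, rfl⟩ := Submodule.Quotient.mk_surjective _ x
    simp only [postcomp, Finsupp.lmapDomain_apply, ModuleCat.hom_ofHom, Submodule.mapQ_apply,
      Category.comp_id, ModuleCat.hom_id, LinearMap.id_coe, id_eq]
    exact congrArg _ Finsupp.mapDomain_id
  map_comp f g := by
    refine ModuleCat.hom_ext (LinearMap.ext fun x => ?_)
    obtain ⟨x, rfl⟩ := Submodule.Quotient.mk_surjective _ x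
    simp [postcomp, ← Finsupp.mapDomain_comp, Function.comp_def]

/-- `V` is (isomorphic to) a basic relative projective module. -/
def IsBasic (V : Mod.{u} m k) : Prop :=
  ∃ (n : Cat m) (W : ModuleCat.{u} k) (ρ : Representation k (End n) W),
    Nonempty (V ≅ basic n ρ)

/-- `V` is relative projective: it has a finite filtration `0 = V^0 ⊆ ⋯ ⊆ V^s = V` all of whose
factors are basic relative projective. -/
def IsRelProj (V : Mod.{u} m k) : Prop :=
  ∃ (s : ℕ) (F : Fin (s + 1) → Subobject V) (hF : ∀ i : Fin s, F i.castSucc ≤ F i.succ),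
    F 0 = ⊥ ∧ F (Fin.last s) = ⊤ ∧
    ∀ i : Fin s, IsBasic (cokernel (Subobject.ofLE (F i.castSucc) (F i.succ) (hF i)))

/-- `K` is a complex `0 → V → F^0 → ⋯ → F^l → 0` with `l ≤ gd(V)`, with relative projective `F^j`
such that `gd(F^j) ≤ gd(V) - j`, and with finitely generated torsion homology (at `V` as well). The
module `V` is placed in position `0` and `F^j` in position `j + 1` of `K`. The length satisfies
`l ≥ -1`, where `l = -1` means the complex `0 → V → 0`, as it has to be for `V = 0`. -/
structure IsRelProjComplex (V : Mod.{u} m k) (l : ℤ) (K : CochainComplex (Mod.{u} m k) ℕ) :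
    Prop where
  start : Nonempty (K.X 0 ≅ V)
  neg_one_le : -1 ≤ l
  length_le : ((l : ℝ) : EReal) ≤ gd V
  isZero : ∀ j : ℕ, l < j → IsZero (K.X (j + 1))
  relProj : ∀ j : ℕ, (j : ℤ) ≤ l → IsRelProj (K.X (j + 1))
  gd_le : ∀ j : ℕ, (j : ℤ) ≤ l → gd (K.X (j + 1)) ≤ gd V - (j : EReal)
  homology_finGen : ∀ p : ℕ, FinGen (K.homology p)
  homology_torsion : ∀ p : ℕ, IsTorsion (K.homology p)

end modules

end FIm

end

/-! Filtrations are replaced by a condition on elements, `Good`: if a morphism f : T → t sends x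
into the span of the images of morphisms whose range does not contain f(U), then x already lies in
the span of the images of morphisms whose range does not contain U. For U = ∅ this says that V is
torsion free; for U the set of all points of T it excludes unexpected relations between generators.
Among modules generated in bounded degree, `Good` characterizes the relative projective ones
(`IsRelProj.good`, `Good.isRelProj`). It passes to extensions and to kernels of surjections
(`IsSES.good_middle`, `IsSES.good_left`), because an inclusion with good quotient is strict for
these spans (`IsSES.mem_spanIn`).

Every finitely generated V has a good iterated shift (`FinGen.exists_good_multiShift`). The
induction is on the generating degree: the cokernel of V → Σ_i V is generated one degree lower, and
treating a point of a nonempty U as the point added by the shift reduces the condition for V to the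
one for this cokernel (`goodAt_of_cokernel`). For empty U the torsion of V must vanish on large
objects, which follows from the Noetherian property (`finGen_of_injective`), proved by a Gröbner
basis argument. The map from V to its good shift has torsion kernel and a cokernel generated one
degree lower. Repeating this with the cokernel gives the complex; it stops because the degree drops
each time, and its cohomology consists of the torsion kernels.

For the last claim, a torsion module vanishes beyond its torsion degrees, so the shifted complex is
exact. Its terms after the first are good and eventually zero; descending through the modules of
cycles with `IsSES.good_left` shows that the shift of V is good. -/

noncomputable section

namespace FIm

/-! ### Points of objects -/

section points

variable {m : ℕ}

/-- The points of an object of `𝒞`: the disjoint union of the finite sets `[n_i]`. -/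
abbrev Pt (t : Cat m) : Type := Σ i, Fin (size t i)

/-- The injection of points induced by a morphism. -/
def ptMap {s t : Cat m} (f : s ⟶ t) (p : Pt s) : Pt t := ⟨p.1, FI.toEmb (f p.1) p.2⟩

@[simp] theorem ptMap_comp {s t r : Cat m} (f : s ⟶ t) (g : t ⟶ r) (p : Pt s) :
    ptMap (f ≫ g) p = ptMap g (ptMap f p) := rfl

theorem ptMap_injective {s t : Cat m} (f : s ⟶ t) : Function.Injective (ptMap f) := by
  rintro ⟨i, x⟩ ⟨j, y⟩ h
  have hij : i = j := congrArg Sigma.fst h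
  subst hij
  have h2 := eq_of_heq (Sigma.mk.inj h).2
  have := (FI.toEmb (f i)).injective h2
  subst this
  rfl

theorem range_ptMap_comp {s t r : Cat m} (f : s ⟶ t) (g : t ⟶ r) :
    Set.range (ptMap (f ≫ g)) = ptMap g '' Set.range (ptMap f) := by
  rw [← Set.range_comp]; rfl

theorem range_ptMap_comp_subset {s t r : Cat m} (f : s ⟶ t) (g : t ⟶ r) :
    Set.range (ptMap (f ≫ g)) ⊆ Set.range (ptMap g) := by
  rintro _ ⟨p, rfl⟩
  exact ⟨ptMap f p, rfl⟩

theorem hom_ext_pt {s t : Cat m} {f g : s ⟶ t} (h : ∀ p, ptMap f p = ptMap g p) : f = g := by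
  funext i
  apply Function.Embedding.ext
  intro x
  exact eq_of_heq (Sigma.mk.inj (h ⟨i, x⟩)).2

theorem card_pt (t : Cat m) : Fintype.card (Pt t) = deg t := by
  simp [deg]

/-- Together with `exists_factor_of_range_subset` this identifies the subobjects of `t` with the
subsets of its points. -/
theorem exists_hom_range (t : Cat m) (U : Set (Pt t)) :
    ∃ (s : Cat m) (g : s ⟶ t), Set.range (ptMap g) = U := by
  classical
  have h : ∀ i, ∃ (a : FI) (f : a ⟶ t i), ∀ x : Fin (size t i),
      (∃ y, FI.toEmb f y = x) ↔ (⟨i, x⟩ : Pt t) ∈ U := by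
    intro i
    let S := {x : Fin (size t i) // (⟨i, x⟩ : Pt t) ∈ U}
    let e := Fintype.equivFin S
    refine ⟨⟨Fintype.card S⟩, (e.symm.toEmbedding.trans (Function.Embedding.subtype _) :
      Fin (Fintype.card S) ↪ Fin (size t i)), fun x => ⟨?_, fun hx => ⟨e ⟨x, hx⟩, ?_⟩⟩⟩
    · rintro ⟨y, rfl⟩
      exact (e.symm y).2
    · change ((e.symm (e ⟨x, hx⟩) : S) : Fin (size t i)) = x
      rw [Equiv.symm_apply_apply]
  choose s g hg using h
  refine ⟨s, g, Set.ext fun p => ⟨?_, fun hp => ?_⟩⟩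
  · rintro ⟨⟨i, y⟩, rfl⟩
    exact (hg i _).1 ⟨y, rfl⟩
  · obtain ⟨i, x⟩ := p
    obtain ⟨y, hy⟩ := (hg i x).2 hp
    exact ⟨⟨i, y⟩, congrArg (Sigma.mk i) hy⟩

theorem exists_factor_of_range_subset {s s' t : Cat m} (f : s ⟶ t) (g : s' ⟶ t)
    (h : Set.range (ptMap f) ⊆ Set.range (ptMap g)) : ∃ k : s ⟶ s', k ≫ g = f := by
  have h1 : ∀ i (x : Fin (size s i)), ∃ y : Fin (size s' i),
      FI.toEmb (g i) y = FI.toEmb (f i) x := by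
    intro i x
    obtain ⟨⟨j, y⟩, hy⟩ := h ⟨⟨i, x⟩, rfl⟩
    have hij : j = i := congrArg Sigma.fst hy
    subst hij
    exact ⟨y, eq_of_heq (Sigma.mk.inj hy).2⟩
  choose k hk using h1
  refine ⟨fun i => (⟨k i, fun x y hxy => (FI.toEmb (f i)).injective ?_⟩ :
    Fin (size s i) ↪ Fin (size s' i)), ?_⟩
  · rw [← hk, ← hk, hxy]
  · funext i
    exact Function.Embedding.ext fun x => hk i x

theorem exists_inverse_of_surjective {s t : Cat m} (f : s ⟶ t)
    (h : Function.Surjective (ptMap f)) : ∃ g : t ⟶ s, f ≫ g = 𝟙 s ∧ g ≫ f = 𝟙 t := by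
  obtain ⟨g, hg⟩ := exists_factor_of_range_subset (𝟙 t) f (by rw [h.range_eq]; simp)
  refine ⟨g, hom_ext_pt fun p => ptMap_injective f ?_, hg⟩
  change ptMap (g ≫ f) (ptMap f p) = ptMap f p
  rw [hg]; rfl

theorem size_le_of_hom {s t : Cat m} (f : s ⟶ t) (i : Fin m) : size s i ≤ size t i := by
  have := Fintype.card_le_of_embedding (FI.toEmb (f i))
  rwa [Fintype.card_fin, Fintype.card_fin] at this

theorem surjective_of_deg_le {s t : Cat m} (f : s ⟶ t) (h : deg t ≤ deg s) :
    Function.Surjective (ptMap f) := by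
  rw [← card_pt, ← card_pt] at h
  exact ((Fintype.bijective_iff_injective_and_card _).2
    ⟨ptMap_injective f, le_antisymm
      (Fintype.card_le_of_injective _ (ptMap_injective f)) h⟩).2

theorem deg_lt_of_not_surjective {s t : Cat m} (f : s ⟶ t)
    (h : ¬ Function.Surjective (ptMap f)) : deg s < deg t :=
  not_le.1 fun h' => h (surjective_of_deg_le f h')

theorem ext_size {s t : Cat m} (h : ∀ i, size s i = size t i) : s = t := by
  funext i
  have := h i
  unfold size at this
  cases hs : s i; cases ht : t i
  rw [hs, ht] at this
  exact congrArg FI.mk this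

theorem eq_of_iso {s t : Cat m} (f : s ⟶ t) (g : t ⟶ s) : s = t :=
  ext_size fun i => le_antisymm (size_le_of_hom f i) (size_le_of_hom g i)

/-- In each coordinate, the points of `s` outside the range of `g` fit into the complement of the
range of `f`, by counting. -/
theorem exists_extension {t s n : Cat m} (f : t ⟶ n) (g : t ⟶ s)
    (h : ∀ i, size s i ≤ size n i) : ∃ k : s ⟶ n, g ≫ k = f := by
  classical
  have key : ∀ i, ∃ k : s i ⟶ n i, g i ≫ k = f i := by
    intro i
    let ge := FI.toEmb (g i)
    let fe := FI.toEmb (f i)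
    let φ : Fin (s i).size → Fin (n i).size := fun y =>
      if hy : ∃ x, ge x = y then fe hy.choose else ⟨y, y.2.trans_le (h i)⟩
    have hφ : ∀ x, φ (ge x) = fe x := by
      intro x
      have hy : ∃ x', ge x' = ge x := ⟨x, rfl⟩
      simp only [φ, dif_pos hy]
      rw [ge.injective hy.choose_spec]
    have hinj : Set.InjOn φ (Set.range ge) := by
      rintro _ ⟨x, rfl⟩ _ ⟨y, rfl⟩ hxy
      rw [hφ, hφ] at hxy
      rw [fe.injective hxy]
    -- A target of exactly the size of `s i` allows the partial injection `φ` to be extended to a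
    -- bijection. The values of `φ` off the range of `ge` play no role.
    have hcard : ∃ T : Finset (Fin (n i).size), (Finset.univ.image fe) ⊆ T ∧
        T.card = (s i).size := by
      obtain ⟨T, h1, _, h2⟩ := Finset.exists_subsuperset_card_eq
        (Finset.subset_univ (Finset.univ.image fe)) (n := (s i).size)
        (by rw [Finset.card_image_of_injective _ fe.injective]
            simpa using Fintype.card_le_of_embedding ge) (by rw [Finset.card_univ, Fintype.card_fin]; exact h i)
      exact ⟨T, h1, h2⟩
    obtain ⟨T, hT, hTc⟩ := hcard
    obtain ⟨e, he⟩ := Set.MapsTo.exists_equiv_extend_of_card_eq (t := T) (s := Set.range ge) (f := φ)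
      (by simp [hTc]) (by
        rintro _ ⟨x, rfl⟩
        rw [hφ]
        exact hT (by simp)) hinj
    refine ⟨(e.toEmbedding.trans (Function.Embedding.subtype _) :
      Fin (s i).size ↪ Fin (n i).size), Function.Embedding.ext fun x => ?_⟩
    exact (he (ge x) ⟨x, rfl⟩).trans (hφ x)
  choose k hk using key
  exact ⟨k, funext hk⟩

/-- The morphism of standard inclusions between objects of coordinatewise increasing size. -/
def homOfLE {s t : Cat m} (h : ∀ i, size s i ≤ size t i) : s ⟶ t :=
  fun i => (Fin.castLEEmb (h i) : Fin (s i).size ↪ Fin (t i).size)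

theorem exists_amalgam {t s r : Cat m} (f : t ⟶ s) (g : t ⟶ r) :
    ∃ (q : Cat m) (h : s ⟶ q) (h' : r ⟶ q), f ≫ h = g ≫ h' := by
  let q : Cat m := fun i => ⟨size s i + size r i⟩
  obtain ⟨k, hk⟩ := exists_extension (f ≫ homOfLE (t := q) fun i => Nat.le_add_right _ _) g
    (fun i => Nat.le_add_left _ _)
  exact ⟨q, _, k, hk.symm⟩

theorem finite_deg_le (d : ℕ) : {t : Cat m | deg t ≤ d}.Finite := by
  refine Set.Finite.of_finite_image (f := fun t : Cat m => size t)
    (Set.Finite.subset (Set.finite_Iic (fun _ => d)) ?_) ?_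
  · rintro _ ⟨t, ht, rfl⟩
    intro i
    exact (Finset.single_le_sum (f := size t) (fun _ _ => Nat.zero_le _) (Finset.mem_univ i)).trans ht
  · intro s _ t _ h
    exact ext_size fun i => congrFun h i

instance (s t : Cat m) : Finite (s ⟶ t) :=
  Finite.of_injective (fun f => (ptMap f : Pt s → Pt t)) fun _ _ h => hom_ext_pt (congrFun h)

/-! ### Points and the self-embeddings -/

/-- When a point is added, `s` consists of the points of `a` not sent to the new point 0. Either 0
is hit and `s` is strictly smaller, or `f` lands in the old points. -/
theorem exists_condSucc_factor (b : Bool) {a c : FI} (f : a ⟶ (condSucc b).obj c) :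
    ∃ (s : FI) (g : a ⟶ (condSucc b).obj s) (h : s ⟶ c), g ≫ (condSucc b).map h = f ∧
      (∀ x, ∃ y, FI.toEmb f y = FI.toEmb ((condPi b).app c) (FI.toEmb h x)) ∧
      s.size ≤ a.size ∧
      (s.size < a.size ∨ ∀ y, ∃ x, FI.toEmb f y = FI.toEmb ((condPi b).app c) x) := by
  classical
  cases b with
  | false => exact ⟨a, 𝟙 _, f, rfl, fun x => ⟨x, rfl⟩, le_rfl, Or.inr fun y => ⟨FI.toEmb f y, rfl⟩⟩
  | true =>
    let fe : Fin a.size ↪ Fin (c.size + 1) := f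
    let S := {x : Fin a.size // fe x ≠ 0}
    let e : S ≃ Fin (Fintype.card S) := Fintype.equivFin S
    let h : Fin (Fintype.card S) ↪ Fin c.size := ⟨fun y => (fe (e.symm y)).pred (e.symm y).2, by
      intro y z hyz
      have := Fin.pred_inj.1 hyz
      exact e.symm.injective (Subtype.ext (fe.injective this))⟩
    let g : Fin a.size ↪ Fin (Fintype.card S + 1) :=
      ⟨fun x => if hx : fe x = 0 then 0 else (e ⟨x, hx⟩).succ, by
        intro x y hxy
        by_cases hx : fe x = 0 <;> by_cases hy : fe y = 0
        · exact fe.injective (hx.trans hy.symm)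
        · simp only [dif_pos hx, dif_neg hy] at hxy
          exact absurd hxy.symm (Fin.succ_ne_zero _)
        · simp only [dif_neg hx, dif_pos hy] at hxy
          exact absurd hxy (Fin.succ_ne_zero _)
        · simp only [dif_neg hx, dif_neg hy] at hxy
          exact congrArg Subtype.val (e.injective (Fin.succ_injective _ hxy))⟩
    refine ⟨⟨Fintype.card S⟩, g, h, Function.Embedding.ext fun x => ?_, fun x => ⟨e.symm x, ?_⟩,
      ?_, ?_⟩
    · change (Fin.cases 0 (fun t => (h t).succ) (g x) : Fin (c.size + 1)) = fe x
      by_cases hx : fe x = 0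
      · simp [g, hx]
      · have hg : g x = (e ⟨x, hx⟩).succ := dif_neg hx
        rw [hg, Fin.cases_succ]
        refine (Fin.succ_pred (fe (e.symm (e ⟨x, hx⟩))) (e.symm (e ⟨x, hx⟩)).2).trans ?_
        rw [Equiv.symm_apply_apply]
    · exact (Fin.succ_pred (fe (e.symm x)) (e.symm x).2).symm
    · exact (Fintype.card_subtype_le (fun x : Fin a.size => fe x ≠ 0)).trans_eq (Fintype.card_fin _)
    · by_cases h0 : ∃ y, fe y = 0
      · left
        obtain ⟨y, hy⟩ := h0
        have := Fintype.card_subtype_lt (p := fun x : Fin a.size => fe x ≠ 0) (x := y) (by simpa using hy)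
        exact this.trans_eq (Fintype.card_fin _)
      · right
        intro y
        have hy : fe y ≠ 0 := fun hy => h0 ⟨y, hy⟩
        exact ⟨(fe y).pred hy, (Fin.succ_pred (fe y) hy).symm⟩

/-- The combinatorial source of the degree drop: a generator seen in Σ_i V either loses a point or
comes from V itself. -/
theorem iota_exists_factor (i : Fin m) {n t : Cat m} (f : n ⟶ (iota i).obj t) :
    ∃ (s : Cat m) (g : n ⟶ (iota i).obj s) (h : s ⟶ t), g ≫ (iota i).map h = f ∧
      (∀ p, ptMap ((piNat i).app t) (ptMap h p) ∈ Set.range (ptMap f)) ∧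
      deg s ≤ deg n ∧
      (deg s < deg n ∨ Set.range (ptMap f) ⊆ Set.range (ptMap ((piNat i).app t))) := by
  have key := fun j => exists_condSucc_factor (decide (j = i)) (f j)
  choose s g h h1 h2 h3 h4 using key
  refine ⟨s, g, h, funext h1, ?_, Finset.sum_le_sum fun j _ => h3 j, ?_⟩
  · rintro ⟨j, x⟩
    obtain ⟨y, hy⟩ := h2 j x
    exact ⟨⟨j, y⟩, congrArg (Sigma.mk j) hy⟩
  · by_cases hj : ∃ j, (s j).size < (n j).size
    · obtain ⟨j, hj⟩ := hj
      exact Or.inl (Finset.sum_lt_sum (fun j _ => h3 j) ⟨j, Finset.mem_univ j, hj⟩)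
    · push Not at hj
      right
      rintro _ ⟨⟨j, y⟩, rfl⟩
      obtain ⟨x, hx⟩ := (h4 j).resolve_left (not_lt.2 (hj j)) y
      exact ⟨⟨j, x⟩, (congrArg (Sigma.mk j) hx).symm⟩

/-- The shifted morphism fixes the added point, so only old points go to old points: the naturality
square of `piNat` is a pullback on points. -/
theorem iota_pullback (i : Fin m) {s t : Cat m} (g : s ⟶ t) (q : Pt ((iota i).obj s)) (w : Pt t)
    (h : ptMap ((iota i).map g) q = ptMap ((piNat i).app t) w) :
    ∃ q', ptMap g q' = w ∧ ptMap ((piNat i).app s) q' = q := by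
  have key : ∀ (b : Bool) {a c : FI} (g : a ⟶ c) (q : Fin ((condSucc b).obj a).size)
      (w : Fin c.size), FI.toEmb ((condSucc b).map g) q = FI.toEmb ((condPi b).app c) w →
      ∃ q', FI.toEmb g q' = w ∧ FI.toEmb ((condPi b).app a) q' = q := by
    intro b a c g q w h
    cases b with
    | false => exact ⟨q, h, rfl⟩
    | true =>
      change Fin (a.size + 1) at q
      change (Fin.cases 0 (fun t => (FI.toEmb g t).succ) q : Fin (c.size + 1)) = w.succ at h
      revert h
      refine Fin.cases (fun h => ?_) (fun x h => ?_) q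
      · exact absurd h.symm (Fin.succ_ne_zero _)
      · exact ⟨x, Fin.succ_injective _ h, rfl⟩
  obtain ⟨j, q⟩ := q
  obtain ⟨j', w⟩ := w
  have hjj : j = j' := congrArg Sigma.fst h
  subst hjj
  obtain ⟨q', h1, h2⟩ := key (decide (j = i)) (g j) q w (eq_of_heq (Sigma.mk.inj h).2)
  exact ⟨⟨j, q'⟩, congrArg (Sigma.mk j) h1, congrArg (Sigma.mk j) h2⟩

theorem piNat_naturality_pt (i : Fin m) {s t : Cat m} (g : s ⟶ t) (p : Pt s) :
    ptMap ((iota i).map g) (ptMap ((piNat i).app s) p) = ptMap ((piNat i).app t) (ptMap g p) :=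
  congrArg (fun f => ptMap f p) ((piNat i).naturality g).symm

theorem eq_of_notMem_range_piNat (i : Fin m) {t : Cat m} {p q : Pt ((iota i).obj t)}
    (hp : p ∉ Set.range (ptMap ((piNat i).app t))) (hq : q ∉ Set.range (ptMap ((piNat i).app t))) :
    p = q := by
  have key : ∀ (b : Bool) {c : FI} (x : Fin ((condSucc b).obj c).size),
      (∀ y, FI.toEmb ((condPi b).app c) y ≠ x) → b = true ∧ x.val = 0 := by
    intro b c x hx
    cases b with
    | false => exact absurd rfl (hx x)
    | true =>
      refine ⟨rfl, ?_⟩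
      change Fin (c.size + 1) at x
      by_contra h0
      have hx0 : x ≠ 0 := fun h => h0 (congrArg Fin.val h)
      exact hx (Fin.pred x hx0) (Fin.succ_pred x hx0)
  obtain ⟨j, p⟩ := p
  obtain ⟨j', q⟩ := q
  obtain ⟨h1, h2⟩ := key (decide (j = i)) p fun y hy => hp ⟨⟨j, y⟩, congrArg (Sigma.mk j) hy⟩
  obtain ⟨h3, h4⟩ := key (decide (j' = i)) q fun y hy => hq ⟨⟨j', y⟩, congrArg (Sigma.mk j') hy⟩
  obtain rfl := of_decide_eq_true h1
  obtain rfl := of_decide_eq_true h3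
  exact congrArg (Sigma.mk _) (Fin.ext (h2.trans h4.symm))

theorem iota_exists_preimage (i : Fin m) {s t : Cat m} (g : (iota i).obj s ⟶ (iota i).obj t)
    (h : ∀ q, ptMap g q ∈ Set.range (ptMap ((piNat i).app t)) ↔
      q ∈ Set.range (ptMap ((piNat i).app s))) :
    ∃ f : s ⟶ t, (iota i).map f = g := by
  have key : ∀ (b : Bool) {a c : FI} (g : (condSucc b).obj a ⟶ (condSucc b).obj c),
      (∀ q, (∃ w, FI.toEmb ((condPi b).app c) w = FI.toEmb g q) ↔
        ∃ w, FI.toEmb ((condPi b).app a) w = q) → ∃ f, (condSucc b).map f = g := by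
    intro b a c g h
    cases b with
    | false => exact ⟨g, rfl⟩
    | true =>
      let ge : Fin (a.size + 1) ↪ Fin (c.size + 1) := g
      have h1 : ∀ x : Fin a.size, ∃ w : Fin c.size, w.succ = ge x.succ :=
        fun x => (h x.succ).2 ⟨x, rfl⟩
      have h0 : ge 0 = 0 := by
        by_contra h0
        obtain ⟨w, hw⟩ := (h (0 : Fin (a.size + 1))).1 ⟨(ge 0).pred h0, Fin.succ_pred (ge 0) h0⟩
        exact Fin.succ_ne_zero _ hw
      choose f hf using h1
      refine ⟨(⟨f, fun x y hxy => ?_⟩ : Fin a.size ↪ Fin c.size), Function.Embedding.ext fun x => ?_⟩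
      · have : ge x.succ = ge y.succ := by rw [← hf, ← hf, hxy]
        exact Fin.succ_injective _ (ge.injective this)
      · change Fin (a.size + 1) at x
        change (Fin.cases 0 (fun t => (f t).succ) x : Fin (c.size + 1)) = ge x
        refine Fin.cases ?_ (fun x => ?_) x
        · exact h0.symm
        · exact hf x
  have key2 : ∀ j, ∃ f : s j ⟶ t j, (condSucc (decide (j = i))).map f = g j := by
    intro j
    refine key (decide (j = i)) (g j) fun q => ⟨?_, ?_⟩
    · rintro ⟨w, hw⟩
      obtain ⟨⟨j', w'⟩, hw'⟩ := (h ⟨j, q⟩).1 ⟨⟨j, w⟩, congrArg (Sigma.mk j) hw⟩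
      have hjj : j' = j := congrArg Sigma.fst hw'
      subst hjj
      exact ⟨w', eq_of_heq (Sigma.mk.inj hw').2⟩
    · rintro ⟨w, hw⟩
      obtain ⟨⟨j', w'⟩, hw'⟩ := (h ⟨j, q⟩).2 ⟨⟨j, w⟩, congrArg (Sigma.mk j) hw⟩
      have hjj : j' = j := congrArg Sigma.fst hw'
      subst hjj
      exact ⟨w', eq_of_heq (Sigma.mk.inj hw').2⟩
  choose f hf using key2
  exact ⟨f, funext hf⟩

/-- Swapping `p` with the first point of its coordinate lets any prescribed point play the role of
the added one. -/
theorem exists_iota_chart {t : Cat m} (p : Pt t) :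
    ∃ (t₀ : Cat m) (β : t ⟶ (iota p.1).obj t₀), Function.Surjective (ptMap β) ∧
      ∀ q, ptMap β q ∈ Set.range (ptMap ((piNat p.1).app t₀)) ↔ q ≠ p := by
  have key : ∀ (b : Bool) (a : FI) (q : b = true → Fin a.size),
      ∃ (a₀ : FI) (β : a ⟶ (condSucc b).obj a₀), Function.Surjective (FI.toEmb β) ∧
        ∀ x, (∃ w, FI.toEmb ((condPi b).app a₀) w = FI.toEmb β x) ↔ ∀ hb, x ≠ q hb := by
    intro b a q
    cases b with
    | false => exact ⟨a, 𝟙 _, fun x => ⟨x, rfl⟩, fun x => ⟨fun _ h => by simp at h,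
        fun _ => ⟨x, rfl⟩⟩⟩
    | true =>
      obtain ⟨a⟩ := a
      obtain ⟨c, rfl⟩ : ∃ c, a = c + 1 := ⟨a - 1, by have := (q rfl).pos; simp only at this; omega⟩
      let x₀ : Fin (c + 1) := q rfl
      let e : Fin (c + 1) ≃ Fin (c + 1) := Equiv.swap x₀ 0
      refine ⟨⟨c⟩, (e.toEmbedding : Fin (c + 1) ↪ Fin (c + 1)), e.surjective, fun x => ?_⟩
      change Fin (c + 1) at x
      change (∃ w : Fin c, w.succ = e x) ↔ ∀ _, x ≠ x₀
      have h1 : (∃ w : Fin c, w.succ = e x) ↔ e x ≠ 0 := Fin.exists_succ_eq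
      have h2 : e x = 0 ↔ x = x₀ := by
        rw [← Equiv.eq_symm_apply]
        simp [e]
      rw [h1, Ne, h2]
      simp
  obtain ⟨i, p⟩ := p
  have key2 := fun j => key (decide (j = i)) (t j)
    (fun hj => (of_decide_eq_true hj) ▸ p)
  choose t₀ β h1 h2 using key2
  refine ⟨t₀, β, ?_, ?_⟩
  · rintro ⟨j, y⟩
    obtain ⟨x, hx⟩ := h1 j y
    exact ⟨⟨j, x⟩, congrArg (Sigma.mk j) hx⟩
  · rintro ⟨j, x⟩
    have h3 : ptMap β ⟨j, x⟩ ∈ Set.range (ptMap ((piNat i).app t₀)) ↔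
        ∃ w, FI.toEmb ((condPi (decide (j = i))).app (t₀ j)) w = FI.toEmb (β j) x := by
      constructor
      · rintro ⟨⟨j', w⟩, hw⟩
        have hjj : j' = j := congrArg Sigma.fst hw
        subst hjj
        exact ⟨w, eq_of_heq (Sigma.mk.inj hw).2⟩
      · rintro ⟨w, hw⟩
        exact ⟨⟨j, w⟩, congrArg (Sigma.mk j) hw⟩
    refine h3.trans ((h2 j x).trans ?_)
    constructor
    · rintro h h'
      have hji : j = i := congrArg Sigma.fst h'
      subst hji
      exact h (by simp) (eq_of_heq (Sigma.mk.inj h').2)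
    · rintro h hj hx
      have hji : j = i := of_decide_eq_true hj
      subst hji
      exact h (congrArg (Sigma.mk j) hx)

end points

section spans

variable {m : ℕ} {k : Type u} [CommRing k]

theorem map_comp_hom (V : Mod.{u} m k) {a b c : Cat m} (f : a ⟶ b) (g : b ⟶ c) (x : V.obj a) :
    (V.map (f ≫ g)).hom x = (V.map g).hom ((V.map f).hom x) := by
  rw [V.map_comp]; rfl

theorem map_id_hom (V : Mod.{u} m k) {a : Cat m} (x : V.obj a) : (V.map (𝟙 a)).hom x = x := by
  rw [V.map_id]; rfl

theorem app_map {V W : Mod.{u} m k} (φ : V ⟶ W) {a b : Cat m} (f : a ⟶ b) (x : V.obj a) :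
    (φ.app b).hom ((V.map f).hom x) = (W.map f).hom ((φ.app a).hom x) := by
  simp

/-! ### Submodules spanned by the images of morphisms of a given kind -/

/-- The span in `V_t` of the images of the maps induced by those morphisms `s → t` that satisfy
the predicate `P`. -/
def spanOf (V : Mod.{u} m k) (t : Cat m) (P : ∀ s : Cat m, (s ⟶ t) → Prop) :
    Submodule k (V.obj t) :=
  Submodule.span k {y | ∃ (s : Cat m) (g : s ⟶ t) (v : V.obj s), P s g ∧ (V.map g).hom v = y}

theorem mem_spanOf {V : Mod.{u} m k} {t : Cat m} {P : ∀ s : Cat m, (s ⟶ t) → Prop} {s : Cat m}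
    (g : s ⟶ t) (h : P s g) (v : V.obj s) : (V.map g).hom v ∈ spanOf V t P :=
  Submodule.subset_span ⟨s, g, v, h, rfl⟩

theorem spanOf_le {V : Mod.{u} m k} {t : Cat m} {P : ∀ s : Cat m, (s ⟶ t) → Prop}
    {N : Submodule k (V.obj t)}
    (h : ∀ (s : Cat m) (g : s ⟶ t) (v : V.obj s), P s g → (V.map g).hom v ∈ N) :
    spanOf V t P ≤ N := by
  refine Submodule.span_le.2 ?_
  rintro _ ⟨s, g, v, hg, rfl⟩
  exact h s g v hg

theorem spanOf_mono {V : Mod.{u} m k} {t : Cat m} {P Q : ∀ s : Cat m, (s ⟶ t) → Prop}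
    (h : ∀ s g, P s g → Q s g) : spanOf V t P ≤ spanOf V t Q :=
  spanOf_le fun _ g v hg => mem_spanOf g (h _ g hg) v

theorem app_mem_spanOf {V W : Mod.{u} m k} (φ : V ⟶ W) {t : Cat m}
    {P : ∀ s : Cat m, (s ⟶ t) → Prop} {x : V.obj t} (hx : x ∈ spanOf V t P) :
    (φ.app t).hom x ∈ spanOf W t P := by
  have : spanOf V t P ≤ (spanOf W t P).comap (φ.app t).hom :=
    spanOf_le fun s g v hg => by
      rw [Submodule.mem_comap, app_map]
      exact mem_spanOf g hg _
  exact this hx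

theorem map_mem_spanOf {V : Mod.{u} m k} {t r : Cat m} (f : t ⟶ r)
    {P : ∀ s : Cat m, (s ⟶ t) → Prop} {Q : ∀ s : Cat m, (s ⟶ r) → Prop}
    (h : ∀ s g, P s g → Q s (g ≫ f)) {x : V.obj t} (hx : x ∈ spanOf V t P) :
    (V.map f).hom x ∈ spanOf V r Q := by
  have : spanOf V t P ≤ (spanOf V r Q).comap (V.map f).hom :=
    spanOf_le fun s g v hg => by
      rw [Submodule.mem_comap, ← map_comp_hom]
      exact mem_spanOf _ (h s g hg) _
  exact this hx

/-- The span of the images of the morphisms whose range does not contain the set `U`. -/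
def missing (V : Mod.{u} m k) (t : Cat m) (U : Set (Pt t)) : Submodule k (V.obj t) :=
  spanOf V t fun _ g => ¬ U ⊆ Set.range (ptMap g)

/-- The span of the images of the morphisms whose range belongs to the family `Δ`. -/
def spanIn (V : Mod.{u} m k) (t : Cat m) (Δ : Set (Set (Pt t))) : Submodule k (V.obj t) :=
  spanOf V t fun _ g => Set.range (ptMap g) ∈ Δ

theorem map_mem_missing {V : Mod.{u} m k} {t r : Cat m} (f : t ⟶ r) {U : Set (Pt t)} {x : V.obj t}
    (hx : x ∈ missing V t U) : (V.map f).hom x ∈ missing V r (ptMap f '' U) := by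
  refine map_mem_spanOf f (fun s g hg h => hg fun p hp => ?_) hx
  obtain ⟨q, hq⟩ := h ⟨p, hp, rfl⟩
  exact ⟨q, ptMap_injective f hq⟩

theorem missing_empty (V : Mod.{u} m k) (t : Cat m) : missing V t ∅ = ⊥ :=
  le_bot_iff.1 (spanOf_le fun _ _ _ hg => absurd (Set.empty_subset _) hg)

/-- `V` is generated by its values at the objects of degree less than `d`. -/
def GenLT (V : Mod.{u} m k) (d : ℕ) : Prop :=
  ∀ t, spanOf V t (fun s _ => deg s < d) = ⊤

/-- The intersection property that characterizes relative projective modules (among those which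
are generated in bounded degree), relative to an object `n`: if the image of `x ∈ V_T` under
`f : T → t` is a combination of elements coming from subobjects of `t` not containing `f(U)`, then
`x` is a combination of elements coming from subobjects of `T` not containing `U`, provided that
`n` embeds into the complement of `U`. -/
def GoodAt (n : Cat m) (V : Mod.{u} m k) : Prop :=
  ∀ (T t : Cat m) (f : T ⟶ t) (U : Set (Pt T)) (r : n ⟶ T),
    (∀ p, ptMap r p ∉ U) → ∀ x : V.obj T, (V.map f).hom x ∈ missing V t (ptMap f '' U) →
      x ∈ missing V T U

/-- The intersection property without restriction on the complement of `U`. -/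
def Good (V : Mod.{u} m k) : Prop :=
  ∀ (T t : Cat m) (f : T ⟶ t) (U : Set (Pt T)) (x : V.obj T),
    (V.map f).hom x ∈ missing V t (ptMap f '' U) → x ∈ missing V T U

theorem GoodAt.mono {n n' : Cat m} (j : n ⟶ n') {V : Mod.{u} m k} (h : GoodAt n V) :
    GoodAt n' V :=
  fun T t f U r hr x hx => h T t f U (j ≫ r) (fun p => hr (ptMap j p)) x hx

/-- The empty object embeds into every complement, so the restriction on `U` is vacuous. -/
theorem GoodAt.good {n : Cat m} (hn : ∀ i, size n i = 0) {V : Mod.{u} m k} (h : GoodAt n V) :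
    Good V :=
  fun T t f U x hx => h T t f U (homOfLE fun i => by rw [hn]; exact Nat.zero_le _)
    (fun p => by have h1 := p.2.pos; have h2 := hn p.1; omega) x hx

theorem Good.goodAt {V : Mod.{u} m k} (h : Good V) (n : Cat m) : GoodAt n V :=
  fun T t f U _ _ x hx => h T t f U x hx

theorem Good.of_iso {V W : Mod.{u} m k} (e : V ≅ W) (h : Good V) : Good W := by
  intro T t f U x hx
  have h1 := h T t f U ((e.inv.app T).hom x) (by
    rw [← app_map]
    exact app_mem_spanOf e.inv hx)
  have h2 := app_mem_spanOf e.hom h1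
  have h3 : (e.hom.app T).hom ((e.inv.app T).hom x) = x := by
    rw [← ModuleCat.comp_apply, ← NatTrans.comp_app, e.inv_hom_id]; rfl
  rwa [h3] at h2

theorem Good.of_subsingleton {V : Mod.{u} m k} (h : ∀ t, Subsingleton (V.obj t)) : Good V := by
  intro T t f U x hx
  rw [(h T).elim x 0]
  exact zero_mem _

/-! ### Short exact sequences -/

/-- A short exact sequence of `𝒞`-modules, stated on elements. -/
structure IsSES {A B C : Mod.{u} m k} (i : A ⟶ B) (p : B ⟶ C) : Prop where
  inj : ∀ t, Function.Injective (i.app t).hom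
  exact : ∀ t x, (p.app t).hom x = 0 ↔ ∃ a, (i.app t).hom a = x
  surj : ∀ t, Function.Surjective (p.app t).hom

theorem lift_mem_spanOf {B C : Mod.{u} m k} (p : B ⟶ C)
    (hp : ∀ t, Function.Surjective (p.app t).hom) {t : Cat m} {P : ∀ s : Cat m, (s ⟶ t) → Prop}
    {y : C.obj t} (hy : y ∈ spanOf C t P) : ∃ x ∈ spanOf B t P, (p.app t).hom x = y := by
  have : spanOf C t P ≤ (spanOf B t P).map (p.app t).hom :=
    spanOf_le fun s g v hg => by
      obtain ⟨w, rfl⟩ := hp s v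
      exact ⟨_, mem_spanOf g hg w, app_map p g w⟩
  exact this hy

/-- All morphisms with the same range as `g` factor through `g`, so their contributions merge into
one element of `V_s`. -/
theorem exists_of_mem_spanIn {V : Mod.{u} m k} {s t : Cat m} (g : s ⟶ t) {Δ : Set (Set (Pt t))}
    {x : V.obj t} (hx : x ∈ spanIn V t Δ) :
    ∃ (y : V.obj s), x - (V.map g).hom y ∈ spanIn V t (Δ \ {Set.range (ptMap g)}) := by
  classical
  have : spanIn V t Δ ≤ LinearMap.range (V.map g).hom ⊔
      spanIn V t (Δ \ {Set.range (ptMap g)}) := by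
    refine spanOf_le fun r h v hh => ?_
    by_cases he : Set.range (ptMap h) = Set.range (ptMap g)
    · obtain ⟨l, rfl⟩ := exists_factor_of_range_subset h g he.le
      rw [map_comp_hom]
      exact Submodule.mem_sup_left ⟨_, rfl⟩
    · exact Submodule.mem_sup_right (mem_spanOf h ⟨hh, he⟩ v)
  obtain ⟨_, ⟨y, rfl⟩, z, hz, rfl⟩ := Submodule.mem_sup.1 (this hx)
  exact ⟨y, by simpa using hz⟩

/-- Strictness of `A → B`, by removing a maximal member of `Δ` at a time. The component of `i a` at
that member can be corrected to come from `A`, because its image in the good module `C` is spanned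
by proper subobjects. -/
theorem IsSES.mem_spanIn {A B C : Mod.{u} m k} {i : A ⟶ B} {p : B ⟶ C} (h : IsSES i p)
    (hC : Good C) {t : Cat m} (Δ : Set (Set (Pt t))) (hΔ : IsLowerSet Δ) (a : A.obj t)
    (ha : (i.app t).hom a ∈ spanIn B t Δ) : a ∈ spanIn A t Δ := by
  induction hc : Δ.ncard generalizing Δ a with
  | zero =>
    have : Δ = ∅ := (Set.ncard_eq_zero (Set.toFinite Δ)).1 hc
    subst this
    have h0 : spanIn B t ∅ = ⊥ := le_bot_iff.1 (spanOf_le fun _ _ _ hg => absurd hg (by simp))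
    rw [h0, Submodule.mem_bot] at ha
    rw [h.inj t (ha.trans (map_zero _).symm)]
    exact zero_mem _
  | succ c ih =>
    obtain ⟨U, hU⟩ := (Set.toFinite Δ).exists_maximal
      (Set.nonempty_of_ncard_ne_zero (by omega))
    obtain ⟨s, g, rfl⟩ := exists_hom_range t U
    obtain ⟨y, hy⟩ := exists_of_mem_spanIn g ha
    have hΔ' : IsLowerSet (Δ \ {Set.range (ptMap g)}) := by
      rintro X Y hYX ⟨hX, hX'⟩
      refine ⟨hΔ hYX hX, fun hY => hX' ?_⟩
      rw [Set.mem_singleton_iff] at hY ⊢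
      subst hY
      exact le_antisymm (hU.2 hX hYX) hYX
    -- Since `p` kills `i a`, pushing `p y` along `g` gives minus the image of the remainder, whose
    -- supports do not contain the maximal set.
    have hpy : (p.app s).hom y ∈ missing C s Set.univ := by
      apply hC s t g
      rw [Set.image_univ]
      have h1 := app_mem_spanOf p hy
      rw [map_sub, (h.exact t _).2 ⟨a, rfl⟩, zero_sub, app_map, neg_mem_iff] at h1
      refine spanOf_mono (fun r l hl hsub => hl.2 ?_) h1
      exact le_antisymm (hU.2 hl.1 hsub) hsub
    obtain ⟨y1, hy1, hy1'⟩ := lift_mem_spanOf p h.surj hpy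
    obtain ⟨a1, ha1⟩ := (h.exact s (y - y1)).1 (by rw [map_sub, hy1', sub_self])
    have hmem : (i.app t).hom (a - (A.map g).hom a1) ∈ spanIn B t (Δ \ {Set.range (ptMap g)}) := by
      -- The correction `y1` comes from proper subobjects of `s`; their ranges in `t` are proper
      -- subsets of a member of the lower set `Δ`.
      have h2 : (B.map g).hom y1 ∈ spanIn B t (Δ \ {Set.range (ptMap g)}) := by
        refine map_mem_spanOf g (fun r l hl => ?_) hy1
        have hlt := range_ptMap_comp_subset l g
        refine ⟨hΔ hlt hU.1, fun he => hl ?_⟩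
        rw [Set.mem_singleton_iff] at he
        intro q _
        obtain ⟨q', hq'⟩ := he.ge ⟨q, rfl⟩
        exact ⟨q', ptMap_injective g hq'⟩
      have h3 := add_mem hy h2
      rw [map_sub, app_map, ha1, map_sub]
      convert h3 using 1
      abel
    have h4 := ih _ hΔ' _ hmem (by
      rw [Set.ncard_sdiff_singleton_of_mem hU.1]; omega)
    have h5 : (A.map g).hom a1 ∈ spanIn A t Δ := mem_spanOf g hU.1 a1
    have h6 : a - (A.map g).hom a1 ∈ spanIn A t Δ := spanOf_mono (fun _ _ h => h.1) h4
    simpa using add_mem h6 h5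

theorem IsSES.mem_missing {A B C : Mod.{u} m k} {i : A ⟶ B} {p : B ⟶ C} (h : IsSES i p)
    (hC : Good C) {t : Cat m} {U : Set (Pt t)} {a : A.obj t}
    (ha : (i.app t).hom a ∈ missing B t U) : a ∈ missing A t U :=
  h.mem_spanIn hC {X | ¬ U ⊆ X} (fun _ _ hYX hX hY => hX (hY.trans hYX)) a ha

theorem IsSES.good_left {A B C : Mod.{u} m k} {i : A ⟶ B} {p : B ⟶ C} (h : IsSES i p)
    (hB : Good B) (hC : Good C) : Good A := by
  intro T t f U a ha
  apply h.mem_missing hC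
  apply hB T t f U
  rw [← app_map]
  exact app_mem_spanOf i ha

/-- The condition in `C` allows `x` to be corrected by an element of the required span until it
comes from `A`; strictness then brings the hypothesis into `A`. -/
theorem IsSES.good_middle {A B C : Mod.{u} m k} {i : A ⟶ B} {p : B ⟶ C} (h : IsSES i p)
    (hA : Good A) (hC : Good C) : Good B := by
  intro T t f U x hx
  have h1 : (p.app T).hom x ∈ missing C T U := by
    apply hC T t f U
    rw [← app_map]
    exact app_mem_spanOf p hx
  obtain ⟨z, hz, hz'⟩ := lift_mem_spanOf p h.surj h1
  obtain ⟨a, ha⟩ := (h.exact T (x - z)).1 (by rw [map_sub, hz', sub_self])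
  have h2 : a ∈ missing A T U := by
    apply hA T t f U
    apply h.mem_missing hC
    rw [app_map, ha, map_sub]
    exact sub_mem hx (map_mem_missing f hz)
  have h3 := add_mem (app_mem_spanOf i h2) hz
  rwa [ha, sub_add_cancel] at h3

end spans

section basic

variable {m : ℕ} {k : Type u} [CommRing k]

theorem surjective_end {n : Cat m} (σ : End n) : Function.Surjective (ptMap (s := n) (t := n) σ) :=
  surjective_of_deg_le _ le_rfl

theorem range_end_comp {n t : Cat m} (σ : End n) (h : n ⟶ t) :
    Set.range (ptMap ((σ : n ⟶ n) ≫ h)) = Set.range (ptMap h) := by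
  rw [range_ptMap_comp, (surjective_end σ).range_eq, Set.image_univ]

/-! ### The intersection property of basic modules -/

variable {n : Cat m} {W : Type u} [AddCommGroup W] [Module k W] (ρ : Representation k (End n) W)

/-- The quotient map from `k𝒞(n, t) ⊗ W` to the value of the basic module. -/
def toBasic (t : Cat m) : ((n ⟶ t) →₀ W) →ₗ[k] (basic n ρ).obj t := (tensorRel n ρ t).mkQ

theorem toBasic_surjective (t : Cat m) : Function.Surjective (toBasic ρ t) :=
  Submodule.mkQ_surjective _

theorem basic_map_toBasic {t t' : Cat m} (g : t ⟶ t') (h : n ⟶ t) (w : W) :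
    ((basic n ρ).map g).hom (toBasic ρ t (Finsupp.single h w)) =
      toBasic ρ t' (Finsupp.single (h ≫ g) w) := by
  change (tensorRel n ρ t').mkQ (postcomp n W g (Finsupp.single h w)) = _
  rw [postcomp, Finsupp.lmapDomain_apply, Finsupp.mapDomain_single]
  rfl

@[elab_as_elim]
theorem basic_induction {t : Cat m} {p : (basic n ρ).obj t → Prop} (x : (basic n ρ).obj t)
    (h0 : p 0) (hadd : ∀ x y, p x → p y → p (x + y))
    (hs : ∀ h w, p (toBasic ρ t (Finsupp.single h w))) : p x := by
  obtain ⟨x, rfl⟩ := toBasic_surjective ρ t x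
  induction x using Finsupp.induction_linear with
  | zero => simpa using h0
  | add f g hf hg => simpa using hadd _ _ hf hg
  | single h w => exact hs h w

/-- The map between values of a basic module induced by an equivariant partial map between sets
of morphisms. -/
def partialMap {t t' : Cat m} (φ : (n ⟶ t) → Option (n ⟶ t'))
    (hφ : ∀ (σ : End n) h, φ ((σ : n ⟶ n) ≫ h) = (φ h).map fun l => (σ : n ⟶ n) ≫ l) :
    (basic n ρ).obj t →ₗ[k] (basic n ρ).obj t' :=
  (tensorRel n ρ t).liftQ
    (Finsupp.lsum k fun h => (φ h).elim 0 fun l => toBasic ρ t' ∘ₗ Finsupp.lsingle l) (by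
      refine Submodule.span_le.2 ?_
      rintro _ ⟨h, σ, w, rfl⟩
      rw [SetLike.mem_coe, LinearMap.mem_ker, map_sub, Finsupp.lsum_single, Finsupp.lsum_single,
        hφ]
      cases φ h with
      | none => simp
      | some l =>
        change toBasic ρ t' (Finsupp.single ((σ : n ⟶ n) ≫ l) w) -
          toBasic ρ t' (Finsupp.single l (ρ σ w)) = 0
        rw [← map_sub]
        exact (Submodule.Quotient.mk_eq_zero _).2 (Submodule.subset_span ⟨l, σ, w, rfl⟩))

theorem partialMap_toBasic {t t' : Cat m} (φ : (n ⟶ t) → Option (n ⟶ t'))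
    (hφ : ∀ (σ : End n) h, φ ((σ : n ⟶ n) ≫ h) = (φ h).map fun l => (σ : n ⟶ n) ≫ l)
    (h : n ⟶ t) (w : W) :
    partialMap ρ φ hφ (toBasic ρ t (Finsupp.single h w)) =
      (φ h).elim 0 fun l => toBasic ρ t' (Finsupp.single l w) := by
  refine (Submodule.liftQ_apply _ _ _).trans ?_
  rw [Finsupp.lsum_single]
  cases φ h <;> rfl

-- There is a linear left inverse: a morphism that factors through `f` goes to its unique factor,
-- any other to zero. It respects the tensor relations because endomorphisms of `n` are invertible.
open Classical in
theorem basic_map_injective {t t' : Cat m} (f : t ⟶ t') :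
    Function.Injective ((basic n ρ).map f).hom := by
  have hcancel : ∀ {a b : n ⟶ t}, a ≫ f = b ≫ f → a = b := fun {a b} h =>
    hom_ext_pt fun p => ptMap_injective f (congrArg (fun l => ptMap l p) h)
  let φ : (n ⟶ t') → Option (n ⟶ t) := fun h =>
    if hh : ∃ l, l ≫ f = h then some hh.choose else none
  have hsome : ∀ l, φ (l ≫ f) = some l := by
    intro l
    have hh : ∃ l', l' ≫ f = l ≫ f := ⟨l, rfl⟩
    simp only [φ, dif_pos hh]
    rw [hcancel hh.choose_spec]
  have hφ : ∀ (σ : End n) h, φ ((σ : n ⟶ n) ≫ h) = (φ h).map fun l => (σ : n ⟶ n) ≫ l := by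
    intro σ h
    by_cases hh : ∃ l, l ≫ f = h
    · obtain ⟨l, rfl⟩ := hh
      rw [← Category.assoc, hsome, hsome]
      rfl
    · have hh' : ¬ ∃ l, l ≫ f = (σ : n ⟶ n) ≫ h := by
        rintro ⟨l, hl⟩
        obtain ⟨τ, h1, h2⟩ := exists_inverse_of_surjective _ (surjective_end σ)
        refine hh ⟨τ ≫ l, ?_⟩
        rw [Category.assoc, hl, ← Category.assoc, h2, Category.id_comp]
      simp only [φ, dif_neg hh, dif_neg hh']
      rfl
  refine Function.LeftInverse.injective (g := partialMap ρ φ hφ) fun x => ?_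
  refine basic_induction ρ x ?_ ?_ ?_
  · rw [map_zero, map_zero]
  · intro x y hx hy
    rw [map_add, map_add, hx, hy]
  · intro h w
    rw [basic_map_toBasic, partialMap_toBasic, hsome]
    rfl

-- The values of a basic module split according to the ranges of morphisms. Projecting to the ranges
-- that contain `U` has kernel exactly `missing`, and pushing along `f` turns this into the
-- projection for f(U). Injectivity of the pushforward finishes the argument.
open Classical in
theorem good_basic : Good (basic n ρ) := by
  let φ : ∀ {t : Cat m} (U : Set (Pt t)), (n ⟶ t) → Option (n ⟶ t) := fun U h =>
    if U ⊆ Set.range (ptMap h) then some h else none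
  have hφ : ∀ {t : Cat m} (U : Set (Pt t)) (σ : End n) h,
      φ U ((σ : n ⟶ n) ≫ h) = (φ U h).map fun l => (σ : n ⟶ n) ≫ l := by
    intro t U σ h
    simp only [φ]
    rw [range_end_comp]
    split_ifs <;> rfl
  have hker : ∀ {t : Cat m} (U : Set (Pt t)) (x : (basic n ρ).obj t),
      x ∈ missing (basic n ρ) t U → partialMap ρ (φ U) (hφ U) x = 0 := by
    intro t U x hx
    have hle : missing (basic n ρ) t U ≤ LinearMap.ker (partialMap ρ (φ U) (hφ U)) := by
      refine spanOf_le fun s g v hg => ?_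
      rw [LinearMap.mem_ker]
      refine basic_induction ρ v ?_ ?_ ?_
      · rw [map_zero, map_zero]
      · intro x y hx hy
        rw [map_add, map_add, hx, hy, add_zero]
      · intro h w
        rw [basic_map_toBasic, partialMap_toBasic]
        have : ¬ U ⊆ Set.range (ptMap (h ≫ g)) :=
          fun h' => hg (h'.trans (range_ptMap_comp_subset _ _))
        simp only [φ, if_neg this]
        rfl
    exact hle hx
  intro T t f U x hx
  have h1 : ((basic n ρ).map f).hom (partialMap ρ (φ U) (hφ U) x) =
      partialMap ρ (φ (ptMap f '' U)) (hφ _) (((basic n ρ).map f).hom x) := by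
    refine basic_induction ρ x ?_ ?_ ?_
    · simp only [map_zero]
    · intro x y hx hy
      simp only [map_add, hx, hy]
    · intro h w
      rw [basic_map_toBasic, partialMap_toBasic, partialMap_toBasic]
      have : ptMap f '' U ⊆ Set.range (ptMap (h ≫ f)) ↔ U ⊆ Set.range (ptMap h) := by
        rw [range_ptMap_comp, Set.image_subset_image_iff (ptMap_injective f)]
      by_cases hU : U ⊆ Set.range (ptMap h)
      · simp only [φ, if_pos hU, if_pos (this.2 hU)]
        exact basic_map_toBasic ρ f h w
      · simp only [φ, if_neg hU, if_neg (this.not.2 hU)]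
        exact map_zero _
  rw [hker _ _ hx] at h1
  have h2 : partialMap ρ (φ U) (hφ U) x = 0 := basic_map_injective ρ f (h1.trans (map_zero _).symm)
  have h3 : ∀ x, x - partialMap ρ (φ U) (hφ U) x ∈ missing (basic n ρ) T U := by
    intro x
    refine basic_induction ρ x ?_ ?_ ?_
    · rw [map_zero, sub_zero]
      exact zero_mem _
    · intro x y hx hy
      rw [map_add, add_sub_add_comm]
      exact add_mem hx hy
    · intro h w
      rw [partialMap_toBasic]
      by_cases hU : U ⊆ Set.range (ptMap h)
      · simp only [φ, if_pos hU]
        change _ - toBasic ρ T (Finsupp.single h w) ∈ _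
        rw [sub_self]
        exact zero_mem _
      · simp only [φ, if_neg hU]
        change _ - 0 ∈ _
        rw [sub_zero]
        have h5 := basic_map_toBasic ρ h (𝟙 n) w
        rw [Category.id_comp] at h5
        rw [← h5]
        exact mem_spanOf h hU _
  simpa [h2] using h3 x

end basic

section criterion

variable {m : ℕ} {k : Type u} [CommRing k]

/-! ### A criterion for a module to be basic -/

/-- The action of the endomorphisms of an object on the value of a module there. -/
def endRep (C : Mod.{u} m k) (n : Cat m) : Representation k (End n) (C.obj n) where
  toFun σ := (C.map σ).hom
  map_one' := LinearMap.ext fun x => map_id_hom C x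
  map_mul' σ τ := LinearMap.ext fun x => map_comp_hom C τ σ x

theorem tensorRel_le_ker (C : Mod.{u} m k) (n t : Cat m) :
    tensorRel n (endRep C n) t ≤
      LinearMap.ker (Finsupp.lsum k fun h : n ⟶ t => (C.map h).hom) := by
  refine Submodule.span_le.2 ?_
  rintro _ ⟨h, σ, w, rfl⟩
  rw [SetLike.mem_coe, LinearMap.mem_ker, map_sub, Finsupp.lsum_single, Finsupp.lsum_single]
  exact sub_eq_zero.2 (map_comp_hom C _ _ _)

/-- The canonical map from the basic module of `C_n` to `C`, at an object. -/
def counitApp (C : Mod.{u} m k) (n t : Cat m) : (basic n (endRep C n)).obj t →ₗ[k] C.obj t :=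
  (tensorRel n (endRep C n) t).liftQ _ (tensorRel_le_ker C n t)

theorem counitApp_toBasic (C : Mod.{u} m k) (n t : Cat m) (a : (n ⟶ t) →₀ C.obj n) :
    counitApp C n t (toBasic _ t a) = a.sum fun h v => (C.map h).hom v :=
  Finsupp.lsum_apply k (fun h : n ⟶ t => (C.map h).hom) a

theorem counitApp_single (C : Mod.{u} m k) (n t : Cat m) (h : n ⟶ t) (v : C.obj n) :
    counitApp C n t (toBasic _ t (Finsupp.single h v)) = (C.map h).hom v := by
  rw [counitApp_toBasic]
  exact Finsupp.sum_single_index (map_zero _)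

/-- The canonical map from the basic module of `C_n` to `C`. -/
def counit (C : Mod.{u} m k) (n : Cat m) : basic n (endRep C n) ⟶ C where
  app t := ModuleCat.ofHom (counitApp C n t)
  naturality t t' g := by
    refine ModuleCat.hom_ext (LinearMap.ext fun x => ?_)
    change counitApp C n t' (((basic n (endRep C n)).map g).hom x) =
      (C.map g).hom (counitApp C n t x)
    refine basic_induction _ x ?_ ?_ ?_
    · simp only [map_zero]
    · intro x y hx hy
      simp only [map_add, hx, hy]
    · intro h w
      rw [basic_map_toBasic, counitApp_single, counitApp_single, map_comp_hom]

/-- Morphisms from `n` with equal ranges differ by an endomorphism of `n`, which the tensor relation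
moves into `W`; one morphism per range suffices. -/
theorem exists_injOn_range {n t : Cat m} {W : Type u} [AddCommGroup W] [Module k W]
    (ρ : Representation k (End n) W) (z : (basic n ρ).obj t) :
    ∃ a : (n ⟶ t) →₀ W, toBasic ρ t a = z ∧
      Set.InjOn (fun h : n ⟶ t => Set.range (ptMap h)) (a.support : Set (n ⟶ t)) := by
  classical
  obtain ⟨a, rfl⟩ := toBasic_surjective ρ t z
  induction a using Finsupp.induction with
  | zero => exact ⟨0, rfl, by simp⟩
  | single_add h w a _ _ ih =>
    obtain ⟨b, hb, hinj⟩ := ih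
    by_cases hex : ∃ l ∈ b.support, Set.range (ptMap l) = Set.range (ptMap h)
    · obtain ⟨l, hl, hlh⟩ := hex
      obtain ⟨σ, hσ⟩ := exists_factor_of_range_subset h l hlh.ge
      refine ⟨Finsupp.single l (ρ σ w) + b, ?_, hinj.mono ?_⟩
      · rw [map_add, map_add, hb]
        congr 1
        refine (sub_eq_zero.1 ?_).symm
        rw [← map_sub]
        exact (Submodule.Quotient.mk_eq_zero _).2
          (Submodule.subset_span ⟨l, σ, w, by rw [hσ]⟩)
      · intro x hx
        have := Finsupp.support_add hx
        rw [Finset.mem_union] at this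
        rcases this with h1 | h1
        · rw [Finset.mem_singleton.1 (Finsupp.support_single_subset h1)]
          exact hl
        · exact h1
    · push Not at hex
      refine ⟨Finsupp.single h w + b, by rw [map_add, map_add, hb], ?_⟩
      intro x hx y hy hxy
      have h1 : ∀ x ∈ (Finsupp.single h w + b).support, x = h ∨ x ∈ b.support := by
        intro x hx
        have := Finsupp.support_add hx
        rw [Finset.mem_union] at this
        exact this.imp_left fun h1 => Finset.mem_singleton.1 (Finsupp.support_single_subset h1)
      rcases h1 x hx with rfl | hx' <;> rcases h1 y hy with rfl | hy'
      · rfl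
      · exact absurd hxy.symm (hex y hy')
      · exact absurd hxy (hex x hx')
      · exact hinj hx' hy' hxy

theorem range_eq_of_subset {n t : Cat m} {g h : n ⟶ t}
    (hgh : Set.range (ptMap g) ⊆ Set.range (ptMap h)) :
    Set.range (ptMap g) = Set.range (ptMap h) := by
  obtain ⟨σ, rfl⟩ := exists_factor_of_range_subset g h hgh
  exact range_end_comp σ h

theorem isIso_of_bijective {V W : Mod.{u} m k} (φ : V ⟶ W)
    (h : ∀ t, Function.Bijective (φ.app t).hom) : IsIso φ := by
  have : ∀ t, IsIso (φ.app t) := fun t => (ConcreteCategory.isIso_iff_bijective _).2 (h t)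
  exact NatIso.isIso_of_isIso_app φ

/-- The canonical map from the basic module on `C_n` is onto by `hgen`. In a relation with pairwise
distinct ranges, no other range contains that of a given `h`, so `hinj` kills the coefficient at
`h`. -/
theorem isBasic_of_generated {C : Mod.{u} m k} {n : Cat m}
    (hgen : ∀ t, spanOf C t (fun s _ => s = n) = ⊤)
    (hinj : ∀ (t : Cat m) (h : n ⟶ t) (x : C.obj n),
      (C.map h).hom x ∈ missing C t (Set.range (ptMap h)) → x = 0) : IsBasic C := by
  classical
  refine ⟨n, C.obj n, endRep C n, ⟨(@asIso _ _ _ _ (counit C n) (isIso_of_bijective _ ?_)).symm⟩⟩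
  refine fun t => ⟨?_, ?_⟩
  · refine (injective_iff_map_eq_zero _).2 fun z hz => ?_
    obtain ⟨a, rfl, ha⟩ := exists_injOn_range _ z
    change counitApp C n t _ = 0 at hz
    rw [counitApp_toBasic] at hz
    suffices a = 0 by rw [this, map_zero]
    refine Finsupp.support_eq_empty.1 (Finset.eq_empty_of_forall_notMem fun h hh => ?_)
    refine Finsupp.mem_support_iff.1 hh (hinj t h _ ?_)
    rw [Finsupp.sum, ← Finset.add_sum_erase _ _ hh] at hz
    rw [eq_neg_of_add_eq_zero_left hz]
    refine neg_mem (sum_mem fun l hl => mem_spanOf l (fun hsub => ?_) _)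
    rw [Finset.mem_erase] at hl
    exact hl.1 (ha hl.2 hh (range_eq_of_subset hsub).symm)
  · rw [← LinearMap.range_eq_top, eq_top_iff, ← hgen t]
    refine spanOf_le ?_
    rintro s g v rfl
    exact ⟨toBasic _ t (Finsupp.single g v), counitApp_single C _ t g v⟩

/-! ### Exactness and evaluation -/

instance (t : Cat m) : ((evaluation (Cat m) (ModuleCat.{u} k)).obj t).PreservesZeroMorphisms where

theorem exact_app_of_exact {S : ShortComplex (Mod.{u} m k)} (hS : S.Exact) (t : Cat m)
    (x : S.X₂.obj t) (hx : (S.g.app t).hom x = 0) : ∃ a, (S.f.app t).hom a = x := by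
  have h1 := hS.map ((evaluation (Cat m) (ModuleCat.{u} k)).obj t)
  exact (ShortComplex.moduleCat_exact_iff _).1 h1 x hx

theorem injective_app_of_mono {V W : Mod.{u} m k} (φ : V ⟶ W) [Mono φ] (t : Cat m) :
    Function.Injective (φ.app t).hom :=
  (ModuleCat.mono_iff_injective _).1 inferInstance

theorem surjective_app_of_epi {V W : Mod.{u} m k} (φ : V ⟶ W) [Epi φ] (t : Cat m) :
    Function.Surjective (φ.app t).hom :=
  (ModuleCat.epi_iff_surjective _).1 inferInstance

theorem comp_app_eq_zero {A B C : Mod.{u} m k} {f : A ⟶ B} {g : B ⟶ C} (h : f ≫ g = 0)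
    {t : Cat m} (x : A.obj t) : (g.app t).hom ((f.app t).hom x) = 0 := by
  rw [← ModuleCat.comp_apply, ← NatTrans.comp_app, h]
  rfl

theorem cokernel_exact {V W : Mod.{u} m k} (φ : V ⟶ W) (t : Cat m) (x : W.obj t) :
    ((cokernel.π φ).app t).hom x = 0 ↔ ∃ a, (φ.app t).hom a = x := by
  constructor
  · exact exact_app_of_exact (S := ShortComplex.mk φ (cokernel.π φ) (cokernel.condition φ))
      (ShortComplex.exact_cokernel φ) t x
  · rintro ⟨a, rfl⟩
    exact comp_app_eq_zero (cokernel.condition φ) a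

theorem isSES_cokernel {V W : Mod.{u} m k} (φ : V ⟶ W) [Mono φ] : IsSES φ (cokernel.π φ) :=
  ⟨injective_app_of_mono φ, cokernel_exact φ, surjective_app_of_epi _⟩

end criterion

/-! ### Relative projective modules and the intersection property -/

section relproj

variable {m : ℕ} {k : Type u} [CommRing k]

theorem GenLT.subsingleton {V : Mod.{u} m k} (hV : GenLT V 0) (t : Cat m) :
    Subsingleton (V.obj t) := by
  have h0 : spanOf V t (fun s _ => deg s < 0) = ⊥ :=
    le_bot_iff.1 (spanOf_le fun _ _ _ h => absurd h (Nat.not_lt_zero _))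
  exact (Submodule.subsingleton_iff k).1 (subsingleton_of_bot_eq_top (h0.symm.trans (hV t)))

theorem GenLT.mono {V : Mod.{u} m k} {d d' : ℕ} (h : d ≤ d') (hV : GenLT V d) : GenLT V d' :=
  fun t => eq_top_iff.2 ((hV t).ge.trans (spanOf_mono fun _ _ hs => lt_of_lt_of_le hs h))

theorem GenLT.of_surjective {V W : Mod.{u} m k} (p : V ⟶ W)
    (hp : ∀ t, Function.Surjective (p.app t).hom) {d : ℕ} (hV : GenLT V d) : GenLT W d := by
  intro t
  refine eq_top_iff.2 fun y _ => ?_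
  obtain ⟨x, rfl⟩ := hp t y
  exact app_mem_spanOf p ((hV t).ge trivial)

theorem bijective_app_of_isIso {V W : Mod.{u} m k} (φ : V ⟶ W) [IsIso φ] (t : Cat m) :
    Function.Bijective (φ.app t).hom :=
  (ConcreteCategory.isIso_iff_bijective (φ.app t)).1 inferInstance

theorem IsBasic.good {V : Mod.{u} m k} (h : IsBasic V) : Good V := by
  obtain ⟨n, W, ρ, ⟨e⟩⟩ := h
  exact (good_basic ρ).of_iso e.symm

theorem subsingleton_of_isZero {V : Mod.{u} m k} (h : IsZero V) (t : Cat m) :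
    Subsingleton (V.obj t) :=
  ModuleCat.subsingleton_of_isZero (((Functor.isZero_iff _).1 h) t)

theorem IsRelProj.good {V : Mod.{u} m k} (h : IsRelProj V) : Good V := by
  obtain ⟨s, F, hF, h0, h1, hb⟩ := h
  have key : ∀ j : Fin (s + 1), Good ((F j : Subobject V) : Mod.{u} m k) := by
    intro j
    induction j using Fin.induction with
    | zero =>
      rw [h0]
      exact Good.of_subsingleton (subsingleton_of_isZero
        ((isZero_zero _).of_iso Subobject.botCoeIsoZero))
    | succ j ih =>
      exact (isSES_cokernel (Subobject.ofLE _ _ (hF j))).good_middle ih (hb j).good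
  have h2 := key (Fin.last s)
  rw [h1] at h2
  exact h2.of_iso (asIso (⊤ : Subobject V).arrow)

/-! ### Submodules as functors -/

/-- The submodule of `V` given by a compatible family of submodules of its values. -/
def subFun (V : Mod.{u} m k) (N : ∀ t, Submodule k (V.obj t))
    (hN : ∀ {t t' : Cat m} (g : t ⟶ t'), N t ≤ (N t').comap (V.map g).hom) : Mod.{u} m k where
  obj t := ModuleCat.of k (N t)
  map g := ModuleCat.ofHom ((V.map g).hom.restrict fun _ hx => hN g hx)
  map_id _ := ModuleCat.hom_ext (LinearMap.ext fun x => Subtype.ext (map_id_hom V x.1))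
  map_comp f g := ModuleCat.hom_ext (LinearMap.ext fun x => Subtype.ext (map_comp_hom V f g x.1))

/-- The inclusion of a submodule of `V`. -/
def subInc (V : Mod.{u} m k) (N : ∀ t, Submodule k (V.obj t))
    (hN : ∀ {t t' : Cat m} (g : t ⟶ t'), N t ≤ (N t').comap (V.map g).hom) :
    subFun V N hN ⟶ V where
  app t := ModuleCat.ofHom (N t).subtype
  naturality _ _ _ := rfl

theorem mono_of_injective {V W : Mod.{u} m k} (φ : V ⟶ W)
    (h : ∀ t, Function.Injective (φ.app t).hom) : Mono φ := by
  have : ∀ t, Mono (φ.app t) := fun t => (ModuleCat.mono_iff_injective _).2 (h t)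
  exact NatTrans.mono_of_mono_app φ

instance (V : Mod.{u} m k) (N : ∀ t, Submodule k (V.obj t))
    (hN : ∀ {t t' : Cat m} (g : t ⟶ t'), N t ≤ (N t').comap (V.map g).hom) :
    Mono (subInc V N hN) :=
  mono_of_injective _ fun t => (N t).injective_subtype

theorem range_subobject_mk {X V : Mod.{u} m k} (φ : X ⟶ V) [Mono φ] (t : Cat m) :
    LinearMap.range ((Subobject.mk φ).arrow.app t).hom = LinearMap.range (φ.app t).hom := by
  rw [← Subobject.underlyingIso_hom_comp_eq_mk φ]
  refine LinearMap.range_comp_of_range_eq_top _ (LinearMap.range_eq_top.2 ?_)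
  exact (bijective_app_of_isIso (Subobject.underlyingIso φ).hom t).2

theorem spanOf_obj_le_comap (V : Mod.{u} m k) (P : Cat m → Prop) {t t' : Cat m} (g : t ⟶ t') :
    spanOf V t (fun s _ => P s) ≤ (spanOf V t' (fun s _ => P s)).comap (V.map g).hom :=
  fun _ hx => map_mem_spanOf g (fun _ _ h => h) hx

/-- The subobject of `V` generated by the values at the objects that satisfy `P`. -/
def genSub (V : Mod.{u} m k) (P : Cat m → Prop) : Subobject V :=
  Subobject.mk (subInc V (fun t => spanOf V t fun s _ => P s) fun g => spanOf_obj_le_comap V P g)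

theorem range_genSub (V : Mod.{u} m k) (P : Cat m → Prop) (t : Cat m) :
    LinearMap.range ((genSub V P).arrow.app t).hom = spanOf V t fun s _ => P s :=
  (range_subobject_mk _ t).trans (Submodule.range_subtype _)

theorem genSub_mono (V : Mod.{u} m k) {P Q : Cat m → Prop} (h : ∀ s, P s → Q s) :
    genSub V P ≤ genSub V Q := by
  refine Subobject.mk_le_mk_of_comm
    { app := fun t => ModuleCat.ofHom (Submodule.inclusion (spanOf_mono fun s _ hs => h s hs))
      naturality := fun _ _ _ => rfl } rfl

theorem genSub_eq_top (V : Mod.{u} m k) {P : Cat m → Prop}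
    (h : ∀ t, spanOf V t (fun s _ => P s) = ⊤) : genSub V P = ⊤ := by
  have : IsIso (subInc V (fun t => spanOf V t fun s _ => P s)
      fun g => spanOf_obj_le_comap V P g) := by
    refine isIso_of_bijective _ fun t => ⟨Submodule.injective_subtype _, fun x => ?_⟩
    exact ⟨⟨x, (h t).ge trivial⟩, rfl⟩
  exact Subobject.mk_eq_top_of_isIso _

theorem genSub_eq_bot (V : Mod.{u} m k) {P : Cat m → Prop} (h : ∀ s, ¬ P s) :
    genSub V P = ⊥ := by
  have h0 : ∀ t, spanOf V t (fun s _ => P s) = ⊥ :=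
    fun t => le_bot_iff.1 (spanOf_le fun s _ _ hs => absurd hs (h s))
  refine (Subobject.mk_eq_bot_iff_zero).2 ?_
  ext t x
  exact (Submodule.mem_bot k).1 ((h0 t).le x.2)

/-! ### Modules with the intersection property are relative projective -/

/-- One step of the filtration by generators: `X` and `Y` are the submodules of `V` generated on `P`
and on `P` together with `n`. Since `P` contains all objects of smaller degree, the condition for
`V` with `U` everything yields the freeness required by `isBasic_of_generated`. -/
theorem isBasic_of_filtration {V X Y C : Mod.{u} m k} (hV : Good V) {P Q : Cat m → Prop}
    {n : Cat m} (hPQ : ∀ s, Q s ↔ P s ∨ s = n) (hlt : ∀ s, deg s < deg n → P s)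
    (hle : ∀ s, P s → s ≠ n ∧ deg s ≤ deg n) {i : X ⟶ Y} {π : Y ⟶ C} (hses : IsSES i π)
    (b : Y ⟶ V) (hinj : ∀ t, Function.Injective (b.app t).hom)
    (hY : ∀ t, LinearMap.range (b.app t).hom = spanOf V t fun s _ => Q s)
    (hX : ∀ t, LinearMap.range ((i ≫ b).app t).hom = spanOf V t fun s _ => P s) :
    IsBasic C := by
  have hmem : ∀ t (y : Y.obj t), (b.app t).hom y ∈ spanOf V t (fun s _ => P s) →
      (π.app t).hom y = 0 := by
    intro t y hy
    rw [← hX] at hy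
    obtain ⟨x, hx⟩ := hy
    exact (hses.exact t y).2 ⟨x, hinj t hx⟩
  refine isBasic_of_generated (n := n) (fun t => ?_) fun t f x hx => ?_
  · refine eq_top_iff.2 fun c _ => ?_
    obtain ⟨y, rfl⟩ := hses.surj t c
    have h1 : spanOf V t (fun s _ => Q s) ≤ ((spanOf C t fun s _ => s = n).comap
        (π.app t).hom).map (b.app t).hom := by
      refine spanOf_le fun s g v hs => ?_
      have hv : v ∈ LinearMap.range (b.app s).hom := by
        rw [hY]
        have := mem_spanOf (V := V) (P := fun s' _ => Q s') (𝟙 s) hs v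
        rwa [map_id_hom] at this
      obtain ⟨y0, rfl⟩ := hv
      refine ⟨(Y.map g).hom y0, ?_, app_map _ _ _⟩
      rw [SetLike.mem_coe, Submodule.mem_comap]
      rcases (hPQ s).1 hs with hP | rfl
      · rw [hmem]
        · exact zero_mem _
        · rw [app_map]
          exact mem_spanOf g hP _
      · rw [app_map]
        exact mem_spanOf g rfl _
    have h2 : (b.app t).hom y ∈ spanOf V t (fun s _ => Q s) := by
      rw [← hY]; exact ⟨y, rfl⟩
    obtain ⟨y', hy', hyy⟩ := h1 h2
    rw [← hinj t hyy]
    exact hy'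
  · obtain ⟨y, rfl⟩ := hses.surj n x
    rw [← app_map] at hx
    obtain ⟨z, hz, hz'⟩ := lift_mem_spanOf π hses.surj hx
    obtain ⟨a, ha⟩ := (hses.exact t ((Y.map f).hom y - z)).1 (by rw [map_sub, hz', sub_self])
    have h3 : (b.app t).hom ((i.app t).hom a) ∈ spanOf V t (fun s _ => P s) := by
      rw [← hX]; exact ⟨a, rfl⟩
    -- An object of `P` has degree at most that of `n` and differs from `n`, so `n` cannot embed
    -- into it.
    have h4 : (spanOf V t fun s _ => P s) ≤ missing V t (Set.range (ptMap f)) := by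
      refine spanOf_mono fun s g hs hsub => (hle s hs).1 ?_
      obtain ⟨l, hl⟩ := exists_factor_of_range_subset f g hsub
      obtain ⟨l', _⟩ := exists_inverse_of_surjective l (surjective_of_deg_le l (hle s hs).2)
      exact eq_of_iso l' l
    have h5 : (b.app t).hom z ∈ missing V t (Set.range (ptMap f)) := app_mem_spanOf b hz
    have h2 : (V.map f).hom ((b.app n).hom y) ∈ missing V t (Set.range (ptMap f)) := by
      have h6 := add_mem (h4 h3) h5
      rwa [ha, ← map_add, sub_add_cancel, app_map] at h6
    rw [← Set.image_univ] at h2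
    have h7 : missing V n Set.univ ≤ spanOf V n fun s _ => P s := by
      refine spanOf_mono fun s g hs => hlt s (deg_lt_of_not_surjective g fun hsur => hs ?_)
      exact hsur.range_eq.ge
    exact hmem n y (h7 (hV n t f Set.univ _ h2))

theorem isBasic_cokernel_genSub {V : Mod.{u} m k} (hV : Good V) {P Q : Cat m → Prop} {n : Cat m}
    (hPQ : ∀ s, Q s ↔ P s ∨ s = n) (hlt : ∀ s, deg s < deg n → P s)
    (hle : ∀ s, P s → s ≠ n ∧ deg s ≤ deg n) (h : genSub V P ≤ genSub V Q) :
    IsBasic (cokernel (Subobject.ofLE _ _ h)) :=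
  isBasic_of_filtration hV hPQ hlt hle (isSES_cokernel (Subobject.ofLE _ _ h))
    (genSub V Q).arrow (injective_app_of_mono _) (range_genSub V Q)
    (fun t => by rw [Subobject.ofLE_arrow]; exact range_genSub V P t)

/-- The finitely many objects of degree below `d` are listed in order of degree, and the filtration
adjoins the values at one object at a time. -/
theorem Good.isRelProj {V : Mod.{u} m k} (hV : Good V) {d : ℕ} (hd : GenLT V d) :
    IsRelProj V := by
  classical
  have hfin : {t : Cat m | deg t < d}.Finite := (finite_deg_le d).subset fun t (ht : deg t < d) => ht.le
  have : Fintype {t : Cat m | deg t < d} := hfin.fintype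
  let s := Fintype.card {t : Cat m | deg t < d}
  let e₀ : Fin s ≃ {t : Cat m | deg t < d} := (Fintype.equivFin _).symm
  let σ := Tuple.sort fun i => deg (e₀ i).1
  let e : Fin s ≃ {t : Cat m | deg t < d} := σ.trans e₀
  have hmono : Monotone fun i => deg (e i).1 := Tuple.monotone_sort fun i => deg (e₀ i).1
  let P : Fin (s + 1) → Cat m → Prop := fun j t => ∃ i : Fin s, i.castSucc < j ∧ (e i).1 = t
  have hle : ∀ j : Fin s, genSub V (P j.castSucc) ≤ genSub V (P j.succ) := fun j =>
    genSub_mono V fun t ⟨i, hi, hit⟩ => ⟨i, hi.trans (Fin.castSucc_lt_succ), hit⟩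
  refine ⟨s, fun j => genSub V (P j), hle, ?_, ?_, fun j => ?_⟩
  · exact genSub_eq_bot V fun t ⟨i, hi, _⟩ => absurd hi (Fin.not_lt_zero _)
  · refine genSub_eq_top V fun t => eq_top_iff.2 ((hd t).ge.trans (spanOf_mono fun r _ hr => ?_))
    exact ⟨e.symm ⟨r, hr⟩, Fin.castSucc_lt_last _, by rw [Equiv.apply_symm_apply]⟩
  · refine isBasic_cokernel_genSub hV (n := (e j).1) (fun t => ?_) (fun t ht => ?_)
      (fun t => ?_) (hle j)
    · constructor
      · rintro ⟨i, hi, rfl⟩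
        rcases (Fin.lt_or_eq_of_le (Fin.castSucc_lt_succ_iff.1 hi)) with h1 | rfl
        · exact Or.inl ⟨i, h1, rfl⟩
        · exact Or.inr rfl
      · rintro (⟨i, hi, rfl⟩ | rfl)
        · exact ⟨i, hi.trans (Fin.castSucc_lt_succ), rfl⟩
        · exact ⟨j, Fin.castSucc_lt_succ, rfl⟩
    · refine ⟨e.symm ⟨t, ht.trans (e j).2⟩, ?_, by rw [Equiv.apply_symm_apply]⟩
      rw [Fin.castSucc_lt_castSucc_iff]
      by_contra hcon
      have h1 := hmono (not_lt.1 hcon)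
      simp only [Equiv.apply_symm_apply] at h1
      omega
    · rintro ⟨i, hi, rfl⟩
      rw [Fin.castSucc_lt_castSucc_iff] at hi
      exact ⟨fun h => hi.ne (e.injective (Subtype.ext h)), hmono hi.le⟩

end relproj

/-! ### A Gröbner basis argument -/

section groebner

variable {k : Type u} [CommRing k]

/-- The elements of `N` all of whose terms are at most `b`. -/
def boundedBy {B : Type} [LinearOrder B] (N : Submodule k (B →₀ k)) (b : B) :
    Submodule k (B →₀ k) :=
  N ⊓ ⨅ c : {c // b < c}, LinearMap.ker (Finsupp.lapply (R := k) c.1)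

theorem mem_boundedBy {B : Type} [LinearOrder B] {N : Submodule k (B →₀ k)} {b : B} {x : B →₀ k} :
    x ∈ boundedBy N b ↔ x ∈ N ∧ ∀ c, b < c → x c = 0 := by
  simp [boundedBy, Submodule.mem_inf, Submodule.mem_iInf]

/-- The ideal of the coefficients at `b` of the elements of `N` with all terms at most `b`. -/
def leadIdeal {B : Type} [LinearOrder B] (N : Submodule k (B →₀ k)) (b : B) : Ideal k :=
  (boundedBy N b).map (Finsupp.lapply b)

theorem mapDomain_mem_boundedBy {B B' : Type} [LinearOrder B] [LinearOrder B']
    {N : Submodule k (B →₀ k)} {N' : Submodule k (B' →₀ k)} {φ : B → B'} (hφ : StrictMono φ)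
    (hN : ∀ x ∈ N, Finsupp.mapDomain φ x ∈ N') {b : B} {x : B →₀ k} (hx : x ∈ boundedBy N b) :
    Finsupp.mapDomain φ x ∈ boundedBy N' (φ b) := by
  rw [mem_boundedBy] at hx ⊢
  refine ⟨hN _ hx.1, fun c hc => ?_⟩
  by_cases h : c ∈ Set.range φ
  · obtain ⟨a, rfl⟩ := h
    rw [Finsupp.mapDomain_apply hφ.injective]
    exact hx.2 a (hφ.lt_iff_lt.1 hc)
  · exact Finsupp.mapDomain_of_notMem_range _ _ h

theorem leadIdeal_le {B B' : Type} [LinearOrder B] [LinearOrder B']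
    {N : Submodule k (B →₀ k)} {N' : Submodule k (B' →₀ k)} {φ : B → B'} (hφ : StrictMono φ)
    (hN : ∀ x ∈ N, Finsupp.mapDomain φ x ∈ N') (b : B) :
    leadIdeal N b ≤ leadIdeal N' (φ b) := by
  rintro _ ⟨x, hx, rfl⟩
  exact ⟨_, mapDomain_mem_boundedBy hφ hN hx, Finsupp.mapDomain_apply hφ.injective x b⟩

theorem WellQuasiOrdered.exists_finset {α : Type*} {r : α → α → Prop} (h : WellQuasiOrdered r) :
    ∃ F : Finset α, ∀ a, ∃ b ∈ F, r b a := by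
  by_contra hcon
  push Not at hcon
  obtain ⟨f, hf⟩ := exists_seq_of_forall_finset_exists (fun _ : α => True) (fun a b => ¬ r a b)
    fun s _ => by
      obtain ⟨a, ha⟩ := hcon s
      exact ⟨a, trivial, ha⟩
  obtain ⟨i, j, hij, hr⟩ := h f
  exact hf.2 i j hij hr

/-- Along a monotone subsequence the labels ascend, hence stabilize. -/
theorem WellQuasiOrdered.and_eq {α : Type*} {r : α → α → Prop} [IsPreorder α r]
    (h : WellQuasiOrdered r) {L : Type*} [PartialOrder L] [WellFoundedGT L] (I : α → L)
    (hI : ∀ a b, r a b → I a ≤ I b) : WellQuasiOrdered fun a b => r a b ∧ I a = I b := by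
  intro f
  obtain ⟨g, hg⟩ := h.exists_monotone_subseq f
  let c : ℕ →o L := ⟨fun n => I (f (g n)), fun a b hab => hI _ _ (hg a b hab)⟩
  obtain ⟨n, hn⟩ := WellFoundedGT.monotone_chain_condition c
  exact ⟨g n, g (n + 1), g.strictMono n.lt_succ_self, hg _ _ n.le_succ, hn _ n.le_succ⟩

/-- By well-quasi-ordering and the ascending chain condition, finitely many monomials dominate all
others with equal ideals of leading coefficients. Elements realizing generators of these ideals
generate `N` by the division algorithm, which ends because each set of monomials is finite. -/
theorem exists_finite_groebner [IsNoetherianRing k] {T : Type} {B : T → Type}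
    [∀ t, LinearOrder (B t)] [∀ t, Finite (B t)] (E : T → T → Type)
    (act : ∀ {t t'}, E t t' → B t → B t') (hact : ∀ {t t'} (ε : E t t'), StrictMono (act ε))
    (hid : ∀ t, ∃ ε : E t t, ∀ b, act ε b = b)
    (hcomp : ∀ {t t' t''} (ε : E t t') (ε' : E t' t''), ∃ ε'' : E t t'', ∀ b,
      act ε'' b = act ε' (act ε b))
    (hwqo : WellQuasiOrdered fun p q : Σ t, B t => ∃ ε : E p.1 q.1, act ε p.2 = q.2)
    (N : ∀ t, Submodule k (B t →₀ k))
    (hN : ∀ {t t'} (ε : E t t') (x), x ∈ N t → Finsupp.mapDomain (act ε) x ∈ N t') :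
    ∃ S : Set (Σ t, B t →₀ k), S.Finite ∧ (∀ x ∈ S, x.2 ∈ N x.1) ∧ ∀ t, ∀ x ∈ N t,
      x ∈ Submodule.span k {y | ∃ s ∈ S, ∃ ε : E s.1 t, Finsupp.mapDomain (act ε) s.2 = y} := by
  classical
  let r : (Σ t, B t) → (Σ t, B t) → Prop := fun p q => ∃ ε : E p.1 q.1, act ε p.2 = q.2
  have hpre : IsPreorder (Σ t, B t) r :=
    { refl := fun p => (hid p.1).imp fun ε h => h p.2
      trans := by
        rintro p q s ⟨ε, hε⟩ ⟨ε', hε'⟩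
        obtain ⟨ε'', h⟩ := hcomp ε ε'
        exact ⟨ε'', by rw [h, hε, hε']⟩ }
  let I : (Σ t, B t) → Ideal k := fun p => leadIdeal (N p.1) p.2
  have hI : ∀ p q, r p q → I p ≤ I q := by
    rintro p q ⟨ε, hε⟩
    have := leadIdeal_le (hact ε) (hN ε) p.2
    rwa [hε] at this
  obtain ⟨F, hF⟩ := WellQuasiOrdered.exists_finset
    (WellQuasiOrdered.and_eq (r := r) hwqo I hI)
  have hgen : ∀ p : Σ t, B t, ∃ G : Finset (B p.1 →₀ k),
      (∀ x ∈ G, x ∈ boundedBy (N p.1) p.2) ∧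
      ∀ c ∈ I p, ∃ z ∈ Submodule.span k (G : Set (B p.1 →₀ k)), z p.2 = c := by
    intro p
    obtain ⟨s, hs⟩ := IsNoetherian.noetherian (I p)
    have h1 : ∀ c : s, ∃ x ∈ boundedBy (N p.1) p.2, x p.2 = c.1 := fun c => by
      have : c.1 ∈ I p := hs.le (Submodule.subset_span c.2)
      exact this
    choose l hl hl' using h1
    refine ⟨Finset.univ.image l, ?_, fun c hc => ?_⟩
    · intro x hx
      obtain ⟨c, _, rfl⟩ := Finset.mem_image.1 hx
      exact hl c
    · have h2 : I p ≤ (Submodule.span k ((Finset.univ.image l : Finset _) : Set (B p.1 →₀ k))).map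
          (Finsupp.lapply p.2) := by
        rw [← hs]
        refine Submodule.span_le.2 fun c hc => ?_
        exact ⟨l ⟨c, hc⟩, Submodule.subset_span (by simp), hl' ⟨c, hc⟩⟩
      exact h2 hc
  choose G hG1 hG2 using hgen
  refine ⟨⋃ p ∈ F, (Sigma.mk p.1) '' (G p : Set (B p.1 →₀ k)),
    F.finite_toSet.biUnion fun p _ => (G p).finite_toSet.image _, ?_, ?_⟩
  · intro x hx
    simp only [Set.mem_iUnion] at hx
    obtain ⟨p, _, y, hy, rfl⟩ := hx
    exact (mem_boundedBy.1 (hG1 p y hy)).1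
  · intro t
    set M : Submodule k (B t →₀ k) := Submodule.span k {y | ∃ s : Σ t, B t →₀ k, s ∈ ⋃ p ∈ F, (Sigma.mk p.1) '' (G p : Set (B p.1 →₀ k)) ∧
      ∃ ε : E s.1 t, Finsupp.mapDomain (act ε) s.2 = y} with hM
    have key : ∀ b : B t, ∀ x ∈ boundedBy (N t) b, x ∈ M := by
      intro b
      induction b using WellFoundedLT.induction with
      | ind b ih =>
        intro x hx
        obtain ⟨p, hp, ⟨ε, hε⟩, hIp⟩ := hF ⟨t, b⟩
        have hε' : act ε p.2 = b := hε
        have hc : x b ∈ I p := by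
          rw [hIp]
          exact ⟨x, hx, rfl⟩
        obtain ⟨z, hz, hzc⟩ := hG2 p _ hc
        have hzb : z ∈ boundedBy (N p.1) p.2 := (Submodule.span_le.2 (hG1 p)) hz
        have hzM : Finsupp.mapDomain (act ε) z ∈ M := by
          have : Submodule.span k (G p : Set (B p.1 →₀ k)) ≤
              M.comap (Finsupp.lmapDomain k k (act ε)) := by
            refine Submodule.span_le.2 fun y hy => ?_
            refine Submodule.subset_span ⟨⟨p.1, y⟩, ?_, ε, rfl⟩
            exact Set.mem_biUnion (x := p) hp ⟨y, hy, rfl⟩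
          exact this hz
        have hzN := mapDomain_mem_boundedBy (hact ε) (hN ε) hzb
        rw [hε'] at hzN
        -- The leading coefficients agree, so subtracting leaves only terms strictly below `b`.
        have hzv : Finsupp.mapDomain (act ε) z b = x b := by
          rw [← hε', Finsupp.mapDomain_apply (hact ε).injective, hzc, hε']
        have hsub := sub_mem hx hzN
        suffices hs : x - Finsupp.mapDomain (act ε) z ∈ M by
          simpa using add_mem hs hzM
        by_cases h0 : (x - Finsupp.mapDomain (act ε) z).support.Nonempty
        · obtain ⟨b1, hb1⟩ := Finset.exists_maximal h0
          have hb1' := Finsupp.mem_support_iff.1 hb1.1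
          have hlt : b1 < b := by
            rcases lt_trichotomy b1 b with h | h | h
            · exact h
            · exact absurd (by rw [h, Finsupp.sub_apply, hzv, sub_self]) hb1'
            · exact absurd ((mem_boundedBy.1 hsub).2 b1 h) hb1'
          refine ih b1 hlt _ (mem_boundedBy.2 ⟨(mem_boundedBy.1 hsub).1, fun c hc => ?_⟩)
          by_contra hne
          exact absurd (hb1.2 (Finsupp.mem_support_iff.2 hne) hc.le) (not_le.2 hc)
        · rw [Finset.not_nonempty_iff_eq_empty, Finsupp.support_eq_empty] at h0
          rw [h0]
          exact zero_mem _
    intro x hx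
    by_cases h0 : x.support.Nonempty
    · obtain ⟨b, hb⟩ := Finset.exists_maximal h0
      refine key b x (mem_boundedBy.2 ⟨hx, fun c hc => ?_⟩)
      by_contra hne
      exact absurd (hb.2 (Finsupp.mem_support_iff.2 hne) hc.le) (not_le.2 hc)
    · rw [Finset.not_nonempty_iff_eq_empty, Finsupp.support_eq_empty] at h0
      rw [h0]
      exact zero_mem _

end groebner

section noetherian

variable {m : ℕ}

/-! ### Morphisms out of finitely many objects as monomials -/

/-- The morphisms to `t` out of a finite family of objects. -/
structure Monomial {r : ℕ} (n : Fin r → Cat m) (t : Cat m) : Type where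
  /-- The index of the source. -/
  idx : Fin r
  /-- The morphism. -/
  hom : n idx ⟶ t

/-- The tuple of values of a morphism, with respect to an enumeration of the points. -/
def values {n t : Cat m} (h : n ⟶ t) (a : Fin (Fintype.card (Pt n))) : ℕ :=
  (ptMap h ((Fintype.equivFin (Pt n)).symm a)).2

theorem values_injective {n t : Cat m} : Function.Injective (values (n := n) (t := t)) := by
  intro g h hgh
  refine hom_ext_pt fun p => ?_
  obtain ⟨a, rfl⟩ := (Fintype.equivFin (Pt n)).symm.surjective p
  exact congrArg (Sigma.mk _) (Fin.ext (congrFun hgh a))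

/-- The index of a monomial together with its tuple of values. -/
def monomialKey {r : ℕ} (n : Fin r → Cat m) (t : Cat m) (b : Monomial n t) :
    Σₗ j : Fin r, Lex (Fin (Fintype.card (Pt (n j))) → ℕ) :=
  toLex ⟨b.idx, toLex (values b.hom)⟩

theorem monomialKey_injective {r : ℕ} (n : Fin r → Cat m) (t : Cat m) :
    Function.Injective (monomialKey n t) := by
  rintro ⟨j, g⟩ ⟨j', h⟩ hgh
  have h1 := toLex.injective hgh
  have hj : j = j' := congrArg Sigma.fst h1
  subst hj
  have h2 := toLex.injective (eq_of_heq (Sigma.mk.inj h1).2)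
  exact congrArg (Monomial.mk j) (values_injective h2)

/-- The lexicographic order on monomials. -/
instance {r : ℕ} (n : Fin r → Cat m) (t : Cat m) : LinearOrder (Monomial n t) :=
  LinearOrder.lift' (monomialKey n t) (monomialKey_injective n t)

instance {r : ℕ} (n : Fin r → Cat m) (t : Cat m) : Finite (Monomial n t) :=
  Finite.of_surjective (fun p : Σ j, (n j ⟶ t) => (⟨p.1, p.2⟩ : Monomial n t))
    fun b => ⟨⟨b.idx, b.hom⟩, rfl⟩

/-- The morphisms all of whose components are strictly increasing. -/
structure Increasing (s t : Cat m) : Type where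
  /-- The underlying morphism. -/
  hom : s ⟶ t
  strictMono : ∀ i, StrictMono (FI.toEmb (hom i))

/-- Postcomposition of monomials with an increasing morphism. -/
def Monomial.push {r : ℕ} {n : Fin r → Cat m} {s t : Cat m} (ε : Increasing s t)
    (b : Monomial n s) : Monomial n t := ⟨b.idx, b.hom ≫ ε.hom⟩

theorem Monomial.push_strictMono {r : ℕ} {n : Fin r → Cat m} {s t : Cat m} (ε : Increasing s t) :
    StrictMono (Monomial.push (n := n) ε) := by
  rintro ⟨j, g⟩ ⟨j', h⟩ hgh
  change monomialKey n s ⟨j, g⟩ < monomialKey n s ⟨j', h⟩ at hgh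
  change monomialKey n t ⟨j, g ≫ ε.hom⟩ < monomialKey n t ⟨j', h ≫ ε.hom⟩
  rw [Sigma.Lex.lt_def] at hgh ⊢
  rcases hgh with hlt | ⟨hj, hlt⟩
  · exact Or.inl hlt
  · change j = j' at hj
    subst hj
    refine Or.inr ⟨rfl, ?_⟩
    obtain ⟨a, ha, ha'⟩ := hlt
    refine ⟨a, fun c hc => ?_, ?_⟩
    · have h1 := ha c hc
      change ((FI.toEmb (ε.hom _)) _ : ℕ) = ((FI.toEmb (ε.hom _)) _ : ℕ)
      congr 2
      exact Fin.ext h1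
    · exact ε.strictMono _ (show (ptMap g _).2 < (ptMap h _).2 from ha')

/-- Each `z` is moved up by the largest displacement h(x) - g(x) over the x with g(x) ≤ z. This
offset is monotone, so the map is strictly increasing; `h3` makes the offset at g(y) equal to h(y) -
g(y), and `h2` keeps the values below the size of `c`. -/
theorem exists_increasing {a b c : FI} (g : a ⟶ b) (h : a ⟶ c) (hsize : b.size ≤ c.size)
    (h1 : ∀ x, (FI.toEmb g x : ℕ) ≤ FI.toEmb h x)
    (h2 : ∀ x, b.size - (FI.toEmb g x : ℕ) ≤ c.size - (FI.toEmb h x : ℕ))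
    (h3 : ∀ x y, (FI.toEmb g y : ℕ) - (FI.toEmb g x : ℕ) ≤
      (FI.toEmb h y : ℕ) - (FI.toEmb h x : ℕ)) :
    ∃ ε : b ⟶ c, StrictMono (FI.toEmb ε) ∧ g ≫ ε = h := by
  classical
  let off : Fin b.size → ℕ := fun z => (Finset.univ.filter fun x => FI.toEmb g x ≤ z).sup
    fun x => (FI.toEmb h x : ℕ) - FI.toEmb g x
  have hoff : Monotone off := by
    intro z w hzw
    refine Finset.sup_mono fun x hx => ?_
    simp only [Finset.mem_filter, Finset.mem_univ, true_and] at hx ⊢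
    exact hx.trans hzw
  have hbound : ∀ z : Fin b.size, (z : ℕ) + off z < c.size := by
    intro z
    rcases (Finset.univ.filter fun x => FI.toEmb g x ≤ z).eq_empty_or_nonempty with he | hne
    · have : off z = 0 := by
        change Finset.sup _ _ = 0
        rw [he, Finset.sup_empty]; rfl
      omega
    · obtain ⟨x, hx, hx'⟩ := Finset.exists_mem_eq_sup _ hne
        fun x => (FI.toEmb h x : ℕ) - FI.toEmb g x
      have hxz : FI.toEmb g x ≤ z := by simpa using hx
      have : off z = (FI.toEmb h x : ℕ) - FI.toEmb g x := hx'
      have hle : (FI.toEmb g x : ℕ) ≤ z := hxz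
      have := h1 x
      have := h2 x
      have := z.2
      have := (FI.toEmb h x).2
      omega
  have hval : ∀ y, off (FI.toEmb g y) = (FI.toEmb h y : ℕ) - FI.toEmb g y := by
    intro y
    refine le_antisymm (Finset.sup_le fun x hx => ?_) (Finset.le_sup (f := fun x =>
      (FI.toEmb h x : ℕ) - FI.toEmb g x) (by simp))
    have hxy : FI.toEmb g x ≤ FI.toEmb g y := by simpa using hx
    rcases hxy.lt_or_eq with hlt | heq
    · have hlt' : (FI.toEmb g x : ℕ) < FI.toEmb g y := hlt
      have := h1 x
      have := h3 x y
      omega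
    · rw [(FI.toEmb g).injective heq]
  have hstrict : StrictMono fun z : Fin b.size => (⟨z + off z, hbound z⟩ : Fin c.size) := by
    intro z w hzw
    have := hoff hzw.le
    exact Fin.mk_lt_mk.2 (add_lt_add_of_lt_of_le (show (z : ℕ) < w from hzw) this)
  refine ⟨(⟨_, hstrict.injective⟩ : Fin b.size ↪ Fin c.size), hstrict,
    Function.Embedding.ext fun y => Fin.ext ?_⟩
  change (FI.toEmb g y : ℕ) + off (FI.toEmb g y) = FI.toEmb h y
  have := h1 y
  rw [hval]
  omega

/-- Dickson's lemma for the tuple of sizes, values, distances to the upper end and truncated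
differences of values, which are the data compared in `exists_increasing`. -/
theorem wellQuasiOrdered_hom (n : Cat m) : WellQuasiOrdered fun p q : Σ t, (n ⟶ t) =>
    ∃ ε : Increasing p.1 q.1, p.2 ≫ ε.hom = q.2 := by
  let val : ∀ p : (Σ t, (n ⟶ t)), Pt n → ℕ := fun p x => (ptMap p.2 x).2
  let u : (Σ t, (n ⟶ t)) → (Fin m → ℕ) × (Pt n → ℕ) × (Pt n → ℕ) × (Pt n × Pt n → ℕ) :=
    fun p => (size p.1, val p, fun x => size p.1 x.1 - val p x,
      fun xy => val p xy.2 - val p xy.1)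
  intro f
  obtain ⟨a, b, hab, hle⟩ := wellQuasiOrdered_le (fun i => u (f i))
  obtain ⟨h0, h1, h2, h3⟩ := hle
  refine ⟨a, b, hab, ?_⟩
  have key : ∀ i, ∃ ε : (f a).1 i ⟶ (f b).1 i, StrictMono (FI.toEmb ε) ∧
      (f a).2 i ≫ ε = (f b).2 i := fun i =>
    exists_increasing _ _ (h0 i) (fun x => h1 ⟨i, x⟩) (fun x => h2 ⟨i, x⟩)
      (fun x y => h3 (⟨i, x⟩, ⟨i, y⟩))
  choose ε hε1 hε2 using key
  exact ⟨⟨ε, hε1⟩, funext hε2⟩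

theorem wellQuasiOrdered_monomial {r : ℕ} (n : Fin r → Cat m) :
    WellQuasiOrdered fun p q : Σ t, Monomial n t =>
      ∃ ε : Increasing p.1 q.1, Monomial.push ε p.2 = q.2 := by
  classical
  intro f
  obtain ⟨j, hj⟩ := Finite.exists_infinite_fiber fun a => (f a).2.idx
  have hinf : Infinite ((fun a => (f a).2.idx) ⁻¹' {j} : Set ℕ) := hj
  let g : ℕ ↪o ℕ := Nat.orderEmbeddingOfSet ((fun a => (f a).2.idx) ⁻¹' {j})
  have hg : ∀ a, ∃ (h : n j ⟶ (f (g a)).1), (f (g a)).2 = (⟨j, h⟩ : Monomial n _) := by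
    intro a
    have h1 : (f (g a)).2.idx = j := by
      have := Nat.orderEmbeddingOfSet_range ((fun a => (f a).2.idx) ⁻¹' {j})
      have h2 : g a ∈ Set.range g := ⟨a, rfl⟩
      exact this.le h2
    have h3 : ∀ {t : Cat m} (q : Monomial n t) {j}, q.idx = j → ∃ h, q = ⟨j, h⟩ := by
      rintro t q _ rfl
      exact ⟨q.hom, rfl⟩
    exact h3 _ h1
  choose h hh using hg
  obtain ⟨a, b, hab, ε, hε⟩ := wellQuasiOrdered_hom (n j) fun a => ⟨_, h a⟩
  refine ⟨g a, g b, g.strictMono hab, ε, ?_⟩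
  rw [hh, hh]
  exact congrArg (Monomial.mk j) hε

/-! ### Submodules of finitely generated modules -/

variable {k : Type u} [CommRing k]

/-- `V` is a quotient of the free modules on monomials, one family per generator, and the preimages
of `A` are stable under increasing morphisms. These morphisms alone already generate the preimages
from a finite set. -/
theorem finGen_of_injective [IsNoetherianRing k] {A V : Mod.{u} m k} (φ : A ⟶ V)
    (hφ : ∀ t, Function.Injective (φ.app t).hom) (hV : FinGen V) : FinGen A := by
  classical
  obtain ⟨S, hS, hgen⟩ := hV
  have : Fintype S := hS.fintype
  let r := Fintype.card S
  let x : Fin r → Σ t : Cat m, V.obj t := fun j => ((Fintype.equivFin S).symm j).1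
  let n : Fin r → Cat m := fun j => (x j).1
  let ev : ∀ t, (Monomial n t →₀ k) →ₗ[k] V.obj t := fun t =>
    Finsupp.lsum k fun b => LinearMap.toSpanSingleton k (V.obj t) ((V.map b.hom).hom (x b.idx).2)
  have hev : ∀ t (b : Monomial n t) c, ev t (Finsupp.single b c) =
      c • (V.map b.hom).hom (x b.idx).2 := fun t b c => by
    refine (Finsupp.lsum_single k _ _ _).trans ?_
    rw [LinearMap.toSpanSingleton_apply]
  have hpush : ∀ {t t'} (ε : Increasing t t') (z : Monomial n t →₀ k),
      ev t' (Finsupp.mapDomain (Monomial.push ε) z) = (V.map ε.hom).hom (ev t z) := by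
    intro t t' ε z
    induction z using Finsupp.induction_linear with
    | zero => simp only [Finsupp.mapDomain_zero, map_zero]
    | add f g hf hg => simp only [Finsupp.mapDomain_add, map_add, hf, hg]
    | single b c =>
      rw [Finsupp.mapDomain_single, hev, hev, map_smul, ← map_comp_hom]
      rfl
  have hsurj : ∀ t, Function.Surjective (ev t) := by
    intro t
    rw [← LinearMap.range_eq_top, eq_top_iff, ← hgen t]
    refine Submodule.span_le.2 ?_
    rintro _ ⟨s, hs, f, rfl⟩
    let j := Fintype.equivFin S ⟨s, hs⟩
    have hj : x j = s := by simp [x, j]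
    obtain ⟨f', hf'⟩ : ∃ f' : n j ⟶ t, (V.map f').hom (x j).2 = (V.map f).hom s.2 := by
      change ∃ f' : (x j).1 ⟶ t, (V.map f').hom (x j).2 = (V.map f).hom s.2
      rw [hj]
      exact ⟨f, rfl⟩
    refine ⟨Finsupp.single (⟨j, f'⟩ : Monomial n t) 1, ?_⟩
    rw [hev, one_smul]
    exact hf'
  let N : ∀ t, Submodule k (Monomial n t →₀ k) := fun t =>
    (LinearMap.range (φ.app t).hom).comap (ev t)
  have hN : ∀ {t t'} (ε : Increasing t t') (z), z ∈ N t →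
      Finsupp.mapDomain (Monomial.push ε) z ∈ N t' := by
    rintro t t' ε z ⟨a, ha⟩
    refine ⟨(A.map ε.hom).hom a, ?_⟩
    rw [app_map, ha, hpush]
  obtain ⟨G, hG, hGN, hGgen⟩ := exists_finite_groebner (T := Cat m) (B := Monomial n) Increasing
    Monomial.push Monomial.push_strictMono
    (fun t => ⟨⟨𝟙 t, fun i => strictMono_id⟩, fun b => rfl⟩)
    (fun ε ε' => ⟨⟨ε.hom ≫ ε'.hom, fun i => (ε'.strictMono i).comp (ε.strictMono i)⟩, fun b => rfl⟩)
    (wellQuasiOrdered_monomial n) N hN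
  have hlift : ∀ z : G, ∃ a : A.obj z.1.1, (φ.app _).hom a = ev _ z.1.2 := fun z => hGN z.1 z.2
  choose l hl using hlift
  have : Finite G := hG
  refine ⟨Set.range fun z : G => ⟨z.1.1, l z⟩, Set.finite_range _, fun t => eq_top_iff.2 ?_⟩
  intro a _
  obtain ⟨z, hz⟩ := hsurj t ((φ.app t).hom a)
  have hzN : z ∈ N t := ⟨a, hz.symm⟩
  have hle : Submodule.span k {y | ∃ s ∈ G, ∃ ε : Increasing s.1 t,
      Finsupp.mapDomain (Monomial.push ε) s.2 = y} ≤
      ((generated A (Set.range fun z : G => ⟨z.1.1, l z⟩) t).map (φ.app t).hom).comap (ev t) := by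
    refine Submodule.span_le.2 ?_
    rintro _ ⟨s, hs, ε, rfl⟩
    refine ⟨(A.map ε.hom).hom (l ⟨s, hs⟩), Submodule.subset_span ⟨_, ⟨⟨s, hs⟩, rfl⟩, ε.hom, rfl⟩, ?_⟩
    rw [app_map, hl ⟨s, hs⟩, hpush]
  obtain ⟨a', ha', haa⟩ := hle (hGgen t z hzN)
  rw [hz] at haa
  rw [← hφ t haa]
  exact ha'

/-! ### Finite generation -/

theorem finGen_iff {V : Mod.{u} m k} :
    FinGen V ↔ (∃ d, GenLT V d) ∧ ∀ t, Module.Finite k (V.obj t) := by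
  classical
  constructor
  · rintro ⟨S, hS, hgen⟩
    have : Finite S := hS
    refine ⟨⟨(hS.toFinset.sup fun x => deg x.1) + 1, fun t => ?_⟩, fun t => ?_⟩
    · rw [eq_top_iff, ← hgen t]
      refine Submodule.span_le.2 ?_
      rintro _ ⟨x, hx, f, rfl⟩
      refine mem_spanOf f ?_ _
      exact Nat.lt_succ_of_le (Finset.le_sup (f := fun x : (Σ t : Cat m, V.obj t) => deg x.1)
        (hS.mem_toFinset.2 hx))
    · refine ⟨?_⟩
      rw [← hgen t]
      refine Submodule.fg_span ?_
      refine (Set.finite_range fun p : (Σ x : S, (x.1.1 ⟶ t)) =>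
        (V.map p.2).hom p.1.1.2).subset ?_
      rintro _ ⟨x, hx, f, rfl⟩
      exact ⟨⟨⟨x, hx⟩, f⟩, rfl⟩
  · rintro ⟨⟨d, hd⟩, hfin⟩
    have h1 : ∀ t, ∃ G : Finset (V.obj t), Submodule.span k (G : Set (V.obj t)) = ⊤ :=
      fun t => (hfin t).fg_top
    choose G hG using h1
    refine ⟨⋃ t ∈ {t : Cat m | deg t ≤ d}, Sigma.mk t '' (G t : Set (V.obj t)),
      (finite_deg_le d).biUnion fun t _ => (G t).finite_toSet.image _, fun t => ?_⟩
    rw [eq_top_iff, ← hd t]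
    refine spanOf_le fun s g v hs => ?_
    have h2 : (⊤ : Submodule k (V.obj s)) ≤ (generated V (⋃ t ∈ {t : Cat m | deg t ≤ d},
        Sigma.mk t '' (G t : Set (V.obj t))) t).comap (V.map g).hom := by
      rw [← hG s]
      refine Submodule.span_le.2 fun y hy => Submodule.subset_span ⟨⟨s, y⟩, ?_, g, rfl⟩
      exact Set.mem_biUnion (x := s) (le_of_lt hs) ⟨y, hy, rfl⟩
    exact h2 trivial

theorem FinGen.of_surjective {V W : Mod.{u} m k} (p : V ⟶ W)
    (hp : ∀ t, Function.Surjective (p.app t).hom) (hV : FinGen V) : FinGen W := by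
  rw [finGen_iff] at hV ⊢
  obtain ⟨⟨d, hd⟩, hfin⟩ := hV
  exact ⟨⟨d, hd.of_surjective p hp⟩, fun t =>
    have := hfin t
    Module.Finite.of_surjective (p.app t).hom (hp t)⟩

end noetherian

section shifts

variable {m : ℕ} {k : Type u} [CommRing k]

/-! ### Shifts -/

theorem size_iota (i : Fin m) (t : Cat m) (j : Fin m) :
    size ((iota i).obj t) j = size t j + if j = i then 1 else 0 := by
  change ((condSucc (decide (j = i))).obj (t j)).size = (t j).size + _
  by_cases h : j = i
  · rw [if_pos h, decide_eq_true h]; rfl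
  · rw [if_neg h, decide_eq_false h]; rfl

/-- The natural map `V → Σ_i V`. -/
def toShift (i : Fin m) (V : Mod.{u} m k) : V ⟶ (shift i).obj V where
  app t := V.map ((piNat i).app t)
  naturality s t f := by
    change V.map f ≫ V.map _ = V.map _ ≫ V.map ((iota i).map f)
    rw [← V.map_comp, ← V.map_comp]
    exact congrArg V.map ((piNat i).naturality f)

theorem toShift_app (i : Fin m) (V : Mod.{u} m k) {t : Cat m} (x : V.obj t) :
    ((toShift i V).app t).hom x = (V.map ((piNat i).app t)).hom x := rfl

theorem mem_missing_of_shift {i : Fin m} {V : Mod.{u} m k} {t : Cat m} {U : Set (Pt t)}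
    {x : V.obj ((iota i).obj t)} (hx : x ∈ missing ((shift i).obj V) t U) :
    x ∈ missing V ((iota i).obj t) (ptMap ((piNat i).app t) '' U) := by
  have hle : missing ((shift i).obj V) t U ≤
      missing V ((iota i).obj t) (ptMap ((piNat i).app t) '' U) := by
    refine spanOf_le fun s g v hg => ?_
    refine mem_spanOf (V := V) ((iota i).map g) (fun hsub => hg fun w hw => ?_) v
    obtain ⟨q, hq⟩ := hsub ⟨w, hw, rfl⟩
    obtain ⟨q', hq', _⟩ := iota_pullback i g q w hq
    exact ⟨q', hq'⟩
  exact hle hx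

theorem mem_missing_shift {i : Fin m} {V : Mod.{u} m k} {t : Cat m} {U : Set (Pt t)}
    {x : V.obj ((iota i).obj t)}
    (hx : x ∈ missing V ((iota i).obj t) (ptMap ((piNat i).app t) '' U)) :
    x ∈ missing ((shift i).obj V) t U := by
  have hle : missing V ((iota i).obj t) (ptMap ((piNat i).app t) '' U) ≤
      missing ((shift i).obj V) t U := by
    refine spanOf_le fun s f v hf => ?_
    obtain ⟨s', g, h, rfl, hr, _⟩ := iota_exists_factor i f
    rw [map_comp_hom]
    refine mem_spanOf (V := (shift i).obj V) h (fun hsub => hf ?_) ((V.map g).hom v)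
    rintro _ ⟨w, hw, rfl⟩
    obtain ⟨p, rfl⟩ := hsub hw
    exact hr p
  exact hle hx

theorem image_iota_map (i : Fin m) {T t : Cat m} (f : T ⟶ t) (U : Set (Pt T)) :
    ptMap ((iota i).map f) '' (ptMap ((piNat i).app T) '' U) =
      ptMap ((piNat i).app t) '' (ptMap f '' U) := by
  rw [Set.image_image, Set.image_image]
  exact Set.image_congr fun p _ => piNat_naturality_pt i f p

/-- The added point always lies outside the image of `U`, so the shift supplies one point of the
room required in the complement. -/
theorem GoodAt.shift {i : Fin m} {n : Cat m} {V : Mod.{u} m k} (h : GoodAt ((iota i).obj n) V) :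
    GoodAt n ((FIm.shift i).obj V) := by
  intro T t f U r hr x hx
  refine mem_missing_shift (h _ _ ((iota i).map f) _ ((iota i).map r) ?_ x ?_)
  · rintro p ⟨w, hw, hwp⟩
    obtain ⟨q, rfl, _⟩ := iota_pullback i r p w hwp.symm
    exact hr q hw
  · rw [image_iota_map]
    exact mem_missing_of_shift hx

theorem Good.shift (i : Fin m) {V : Mod.{u} m k} (h : Good V) : Good ((FIm.shift i).obj V) :=
  GoodAt.good (n := fun _ => ⟨0⟩) (fun _ => rfl) (h.goodAt _).shift

theorem exists_factor_piNat (i : Fin m) {s t : Cat m} (f : s ⟶ (iota i).obj t)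
    (h : Set.range (ptMap f) ⊆ Set.range (ptMap ((piNat i).app t))) :
    ∃ f' : s ⟶ t, f' ≫ (piNat i).app t = f :=
  exists_factor_of_range_subset f ((piNat i).app t) h

/-- Equivalently, the cokernel of V → Σ_i V is generated one degree lower: a generator missing the
added point comes from `V`, any other loses a point. -/
theorem GenLT.mem_shift {i : Fin m} {V : Mod.{u} m k} {d : ℕ} (hV : GenLT V (d + 1)) {t : Cat m}
    (y : ((shift i).obj V).obj t) :
    y ∈ LinearMap.range ((toShift i V).app t).hom ⊔
      spanOf ((shift i).obj V) t fun s _ => deg s < d := by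
  set M : Submodule k (((shift i).obj V).obj t) := LinearMap.range ((toShift i V).app t).hom ⊔
    spanOf ((shift i).obj V) t fun s _ => deg s < d
  have hl : ∀ v : V.obj t, ((toShift i V).app t).hom v ∈ M :=
    fun v => Submodule.mem_sup_left ⟨v, rfl⟩
  have hr : ∀ {s : Cat m} (h : s ⟶ t) (v : ((shift i).obj V).obj s), deg s < d →
      (((shift i).obj V).map h).hom v ∈ M :=
    fun h v hs => Submodule.mem_sup_right (mem_spanOf h hs v)
  have hle : (⊤ : Submodule k (V.obj ((iota i).obj t))) ≤ M := by
    rw [← hV]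
    refine spanOf_le fun s f v hs => ?_
    obtain ⟨s', g, h, hgh, _, hd, hor⟩ := iota_exists_factor i f
    rcases hor with hlt | hsub
    · rw [← hgh, map_comp_hom]
      exact hr h ((V.map g).hom v) (by omega)
    · obtain ⟨f', rfl⟩ := exists_factor_piNat i f hsub
      rw [map_comp_hom]
      exact hl ((V.map f').hom v)
  exact hle trivial

theorem GenLT.shift (i : Fin m) {V : Mod.{u} m k} {d : ℕ} (hV : GenLT V d) :
    GenLT ((FIm.shift i).obj V) d := by
  intro t
  have hle : (⊤ : Submodule k (V.obj ((iota i).obj t))) ≤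
      spanOf ((FIm.shift i).obj V) t fun s _ => deg s < d := by
    rw [← hV]
    refine spanOf_le fun s f v hs => ?_
    obtain ⟨s', g, h, rfl, _, hd, _⟩ := iota_exists_factor i f
    rw [map_comp_hom]
    exact mem_spanOf (V := (FIm.shift i).obj V) h (lt_of_le_of_lt hd hs) ((V.map g).hom v)
  exact eq_top_iff.2 hle

theorem FinGen.shift (i : Fin m) {V : Mod.{u} m k} (hV : FinGen V) :
    FinGen ((FIm.shift i).obj V) := by
  rw [finGen_iff] at hV ⊢
  obtain ⟨⟨d, hd⟩, hfin⟩ := hV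
  exact ⟨⟨d, hd.shift i⟩, fun t => hfin _⟩

theorem multiShift_induction {P : Mod.{u} m k → Prop} (hP : ∀ i W, P W → P ((shift i).obj W))
    (n : Fin m → ℕ) {V : Mod.{u} m k} (hV : P V) : P (multiShift n V) := by
  unfold multiShift
  induction List.finRange m with
  | nil => exact hV
  | cons i l ih =>
    rw [List.foldr_cons]
    have key : ∀ c : ℕ, ∀ W, P W → P ((shift i).obj^[c] W) := by
      intro c
      induction c with
      | zero => exact fun W hW => hW
      | succ c ihc =>
        intro W hW
        rw [Function.iterate_succ_apply]
        exact ihc _ (hP i W hW)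
    exact key _ _ ih

theorem FinGen.multiShift (n : Fin m → ℕ) {V : Mod.{u} m k} (hV : FinGen V) :
    FinGen (FIm.multiShift n V) :=
  multiShift_induction (fun i _ h => h.shift i) n hV

theorem Good.multiShift (n : Fin m → ℕ) {V : Mod.{u} m k} (hV : Good V) :
    Good (FIm.multiShift n V) :=
  multiShift_induction (fun i _ h => h.shift i) n hV

theorem GenLT.multiShift (n : Fin m → ℕ) {V : Mod.{u} m k} {d : ℕ} (hV : GenLT V d) :
    GenLT (FIm.multiShift n V) d :=
  multiShift_induction (P := fun W => GenLT W d) (fun i _ h => h.shift i) n hV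

theorem exists_multiShift_functor (n : Fin m → ℕ) :
    ∃ Θ : Cat m ⥤ Cat m, (∀ V : Mod.{u} m k, multiShift n V = Θ ⋙ V) ∧
      (∀ t i, size (Θ.obj t) i = size t i + n i) ∧
      ∀ (V : Mod.{u} m k) a, GoodAt (Θ.obj a) V → GoodAt a (Θ ⋙ V) := by
  have key : ∀ l : List (Fin m), ∃ Θ : Cat m ⥤ Cat m,
      (∀ V : Mod.{u} m k, l.foldr (fun i W => (shift i).obj^[n i] W) V = Θ ⋙ V) ∧
      (∀ t i, size (Θ.obj t) i = size t i + l.count i * n i) ∧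
      ∀ (V : Mod.{u} m k) a, GoodAt (Θ.obj a) V → GoodAt a (Θ ⋙ V) := by
    intro l
    induction l with
    | nil => exact ⟨𝟭 _, fun V => rfl, fun t i => by simp, fun V a h => h⟩
    | cons i l ih =>
      obtain ⟨Θ, h1, h2, h3⟩ := ih
      have key2 : ∀ c : ℕ, ∃ Θ' : Cat m ⥤ Cat m,
          (∀ V : Mod.{u} m k, (shift i).obj^[c] (Θ ⋙ V) = Θ' ⋙ V) ∧
          (∀ t j, size (Θ'.obj t) j = size t j + l.count j * n j + if j = i then c else 0) ∧
          ∀ (V : Mod.{u} m k) a, GoodAt (Θ'.obj a) V → GoodAt a (Θ' ⋙ V) := by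
        intro c
        induction c with
        | zero => exact ⟨Θ, fun V => rfl, fun t j => by simp [h2], h3⟩
        | succ c ihc =>
          obtain ⟨Θ', h1', h2', h3'⟩ := ihc
          refine ⟨iota i ⋙ Θ', fun V => ?_, fun t j => ?_, fun V a h => ?_⟩
          · rw [Function.iterate_succ_apply', h1']
            rfl
          · rw [Functor.comp_obj, h2', size_iota]
            split_ifs <;> omega
          · exact (h3' V _ h).shift
      obtain ⟨Θ', h1', h2', h3'⟩ := key2 (n i)
      refine ⟨Θ', fun V => ?_, fun t j => ?_, h3'⟩
      · rw [List.foldr_cons, h1, h1']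
      · rw [h2', List.count_cons]
        by_cases hj : j = i
        · subst hj
          simp; ring
        · simp [hj, Ne.symm hj]
  obtain ⟨Θ, h1, h2, h3⟩ := key (List.finRange m)
  refine ⟨Θ, h1, fun t i => ?_, h3⟩
  rw [h2, List.count_eq_one_of_mem (List.nodup_finRange m) (List.mem_finRange i), one_mul]

/-! ### Torsion -/

theorem IsTorsionElt.map {V : Mod.{u} m k} {s t : Cat m} (f : s ⟶ t) {x : V.obj s}
    (hx : IsTorsionElt V x) : IsTorsionElt V ((V.map f).hom x) := by
  obtain ⟨r, g, hg⟩ := hx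
  obtain ⟨q, h, h', hh⟩ := exists_amalgam f g
  exact ⟨q, h, by rw [← map_comp_hom, hh, map_comp_hom, hg, map_zero]⟩

theorem IsTorsionElt.add {V : Mod.{u} m k} {t : Cat m} {x y : V.obj t}
    (hx : IsTorsionElt V x) (hy : IsTorsionElt V y) : IsTorsionElt V (x + y) := by
  obtain ⟨r, g, hg⟩ := hx
  obtain ⟨r', g', hg'⟩ := hy
  obtain ⟨q, h, h', hh⟩ := exists_amalgam g g'
  exact ⟨q, g ≫ h, by rw [map_add, map_comp_hom, hg, hh, map_comp_hom, hg', map_zero, map_zero,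
    add_zero]⟩

/-- The submodule of torsion elements. -/
def torsionSub (V : Mod.{u} m k) (t : Cat m) : Submodule k (V.obj t) where
  carrier := {x | IsTorsionElt V x}
  add_mem' := IsTorsionElt.add
  zero_mem' := ⟨t, 𝟙 t, map_zero _⟩
  smul_mem' c x := by
    rintro ⟨r, g, hg⟩
    exact ⟨r, g, by rw [map_smul, hg, smul_zero]⟩

/-- The object with prescribed sizes. -/
def objOf (c : Fin m → ℕ) : Cat m := fun i => ⟨c i⟩

theorem exists_sub (V : Mod.{u} m k) (N : ∀ t, Submodule k (V.obj t))
    (hN : ∀ {t t' : Cat m} (g : t ⟶ t'), N t ≤ (N t').comap (V.map g).hom) :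
    ∃ (A : Mod.{u} m k) (i : A ⟶ V), (∀ t, Function.Injective (i.app t).hom) ∧
      ∀ t x, (∃ a, (i.app t).hom a = x) ↔ x ∈ N t :=
  ⟨subFun V N hN, subInc V N hN, fun t => (N t).injective_subtype, fun _ _ =>
    ⟨by rintro ⟨a, rfl⟩; exact a.2, fun hx => ⟨⟨_, hx⟩, rfl⟩⟩⟩

/-- The torsion submodule is finitely generated. On an object larger than the targets of morphisms
killing its generators, every morphism from a generator factors through the killing one. -/
theorem FinGen.exists_torsion_bound [IsNoetherianRing k] {V : Mod.{u} m k} (hV : FinGen V) :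
    ∃ n : Cat m, ∀ (T : Cat m) (_ : n ⟶ T) (t : Cat m) (f : T ⟶ t) (x : V.obj T),
      (V.map f).hom x = 0 → x = 0 := by
  obtain ⟨A, i, hi, hA⟩ := exists_sub V (torsionSub V) fun g x hx => IsTorsionElt.map g hx
  obtain ⟨S, hS, hgen⟩ := finGen_of_injective i hi hV
  have hex : ∀ x : (Σ t, A.obj t), ∃ (t : Cat m) (f : x.1 ⟶ t),
      (V.map f).hom ((i.app _).hom x.2) = 0 := fun x => (hA _ _).1 ⟨x.2, rfl⟩
  choose b f hf using hex
  refine ⟨objOf fun i => hS.toFinset.sup fun x => size (b x) i, fun T r t g x hx => ?_⟩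
  have hle : generated A S T ≤ ⊥ := by
    refine Submodule.span_le.2 ?_
    rintro _ ⟨y, hy, h, rfl⟩
    obtain ⟨l, hl⟩ := exists_extension h (f y) fun i =>
      (Finset.le_sup (f := fun x => size (b x) i) (hS.mem_toFinset.2 hy)).trans
        (size_le_of_hom r i)
    refine (Submodule.mem_bot k).2 (hi T ?_)
    rw [app_map, ← hl, map_comp_hom, hf, map_zero, map_zero]
  obtain ⟨a, rfl⟩ := (hA T x).2 ⟨t, g, hx⟩
  have ha : a ∈ (⊥ : Submodule k (A.obj T)) := hle ((hgen T).ge trivial)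
  rw [(Submodule.mem_bot k).1 ha, map_zero]

/-! ### The intersection property from the cokernels of the maps to the shifts -/

/-- For nonempty `U`, a point p of `U` and its image f(p) are made the added points, so that `f`
becomes a shifted morphism and `x` an element of Σ_i V. Modulo `V` the contributions missing f(p)
vanish, and the condition for the cokernel handles the rest. What is left of `x` comes from `V`,
hence misses p. -/
theorem goodAt_of_cokernel {n : Cat m} {V : Mod.{u} m k}
    (hD : ∀ i, GoodAt n (cokernel (toShift i V)))
    (htors : ∀ (T : Cat m) (_ : n ⟶ T) (t : Cat m) (f : T ⟶ t) (x : V.obj T),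
      (V.map f).hom x = 0 → x = 0) : GoodAt n V := by
  intro T t f U r hr x hx
  rcases U.eq_empty_or_nonempty with rfl | ⟨p, hp⟩
  · rw [Set.image_empty, missing_empty, Submodule.mem_bot] at hx
    rw [htors T r t f x hx]
    exact zero_mem _
  let i := p.1
  obtain ⟨T₀, α, hα, hα'⟩ := exists_iota_chart p
  obtain ⟨t₀, β, hβ, hβ'⟩ := exists_iota_chart (ptMap f p)
  change t ⟶ (iota i).obj t₀ at β
  obtain ⟨α', hαα', hα'α⟩ := exists_inverse_of_surjective α hα
  set C := cokernel (toShift i V)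
  set c : (shift i).obj V ⟶ C := cokernel.π (toShift i V)
  have hc : ∀ t y, (c.app t).hom y = 0 ↔ ∃ a, ((toShift i V).app t).hom a = y :=
    cokernel_exact _
  have hpT : ptMap α p ∉ Set.range (ptMap ((piNat i).app T₀)) := fun h => (hα' p).1 h rfl
  have hpt : ptMap β (ptMap f p) ∉ Set.range (ptMap ((piNat i).app t₀)) :=
    fun h => (hβ' _).1 h rfl
  have hff : ∃ f₀ : T₀ ⟶ t₀, (iota i).map f₀ = α' ≫ f ≫ β := by
    refine iota_exists_preimage i _ fun q => ?_
    obtain ⟨q, rfl⟩ := hα q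
    have h1 : ptMap α' (ptMap α q) = q := by rw [← ptMap_comp, hαα']; rfl
    rw [ptMap_comp, ptMap_comp, h1]
    refine (hβ' (ptMap f q)).trans (Iff.trans ?_ (hα' q).symm)
    exact not_congr (ptMap_injective f).eq_iff
  obtain ⟨f₀, hf₀⟩ := hff
  set U₀ : Set (Pt T₀) := {w | ptMap ((piNat i).app T₀) w ∈ ptMap α '' U} with hU₀
  have hsuff : (V.map α).hom x ∈ missing V _ (ptMap α '' U) → x ∈ missing V T U := by
    intro h
    have h1 := map_mem_missing α' h
    rw [← map_comp_hom, hαα', map_id_hom, Set.image_image] at h1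
    have h2 : (fun q => ptMap α' (ptMap α q)) = id := by
      funext q
      rw [← ptMap_comp, hαα']; rfl
    rwa [h2, Set.image_id] at h1
  apply hsuff
  obtain ⟨y, hy⟩ : ∃ y : ((shift i).obj V).obj T₀, y = (V.map α).hom x := ⟨_, rfl⟩
  have hyf : (((shift i).obj V).map f₀).hom y = (V.map β).hom ((V.map f).hom x) := by
    have h : (V.map ((iota i).map f₀)).hom ((V.map α).hom x) =
        (V.map β).hom ((V.map f).hom x) := by
      rw [hf₀, map_comp_hom, map_comp_hom, ← map_comp_hom V α α', hαα', map_id_hom]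
    exact (congrArg (fun z => (((shift i).obj V).map f₀).hom z) hy).trans h
  obtain ⟨r₀, hr₀⟩ : ∃ r₀ : n ⟶ T₀, r₀ ≫ (piNat i).app T₀ = r ≫ α := by
    refine exists_factor_piNat i _ ?_
    rintro _ ⟨q, rfl⟩
    refine (hα' (ptMap r q)).2 fun h => hr q ?_
    rw [h]
    exact hp
  have hmain : (c.app T₀).hom y ∈ missing C T₀ U₀ := by
    apply hD i T₀ t₀ f₀ U₀ r₀
    · intro q hq
      rw [hU₀, Set.mem_ofPred_eq, ← ptMap_comp, hr₀] at hq
      obtain ⟨q', hq', hqq⟩ := hq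
      rw [ptMap_comp] at hqq
      exact hr q (ptMap_injective α hqq ▸ hq')
    · rw [← app_map, hyf]
      have hx' := map_mem_missing β hx
      have hle : missing V ((iota i).obj t₀) (ptMap β '' (ptMap f '' U)) ≤
          (missing C t₀ (ptMap f₀ '' U₀)).comap (c.app t₀).hom := by
        refine spanOf_le fun s g v hg => ?_
        change (c.app t₀).hom ((V.map g).hom v) ∈ missing C t₀ (ptMap f₀ '' U₀)
        -- If `g` avoids the added point, it contributes zero in the cokernel. Otherwise it hits
        -- f(p), so what it misses of f(U) corresponds to a point of `U₀`.
        by_cases hsub : Set.range (ptMap g) ⊆ Set.range (ptMap ((piNat i).app t₀))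
        · obtain ⟨g', rfl⟩ := exists_factor_piNat i g hsub
          have h0 : (c.app t₀).hom ((V.map (g' ≫ (piNat i).app t₀)).hom v) = 0 :=
            (hc t₀ _).2 ⟨(V.map g').hom v, by rw [map_comp_hom]; rfl⟩
          rw [h0]
          exact zero_mem _
        · obtain ⟨s', g₁, h, rfl, hrange, _⟩ := iota_exists_factor i g
          have h1 : (c.app t₀).hom ((V.map (g₁ ≫ (iota i).map h)).hom v) =
              (C.map h).hom ((c.app s').hom ((V.map g₁).hom v)) := by
            rw [map_comp_hom]
            exact app_map c h _
          rw [h1]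
          refine mem_spanOf h (fun hsub' => hg ?_) _
          rintro _ ⟨_, ⟨u, hu, rfl⟩, rfl⟩
          by_cases hup : u = p
          · subst hup
            obtain ⟨_, ⟨q, rfl⟩, hq⟩ := Set.not_subset.1 hsub
            exact ⟨q, eq_of_notMem_range_piNat i hq hpt⟩
          · obtain ⟨w, hw⟩ := (hα' u).2 hup
            have hwU : w ∈ U₀ := ⟨u, hu, hw.symm⟩
            obtain ⟨q, hq⟩ := hsub' ⟨w, hwU, rfl⟩
            have h2 : ptMap β (ptMap f u) = ptMap ((piNat i).app t₀) (ptMap f₀ w) := by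
              rw [← piNat_naturality_pt, hw, hf₀, ptMap_comp, ptMap_comp]
              congr 2
              rw [← ptMap_comp, hαα']; rfl
            rw [h2, ← hq]
            exact hrange q
      exact hle hx'
  obtain ⟨z, hz, hz'⟩ := lift_mem_spanOf c (surjective_app_of_epi c) hmain
  obtain ⟨a, ha⟩ := (hc T₀ (y - z)).1 (by rw [map_sub, hz', sub_self])
  have hpα : ptMap α p ∈ ptMap α '' U := ⟨p, hp, rfl⟩
  have h1 : (V.map ((piNat i).app T₀)).hom a ∈ missing V _ (ptMap α '' U) :=
    mem_spanOf _ (fun hsub => hpT (hsub hpα)) a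
  have h2 : z ∈ missing V ((iota i).obj T₀) (ptMap α '' U) := by
    have hle : missing V ((iota i).obj T₀) (ptMap ((piNat i).app T₀) '' U₀) ≤
        missing V ((iota i).obj T₀) (ptMap α '' U) := by
      refine spanOf_mono fun s g hg hsub => hg ?_
      rintro _ ⟨w, hw, rfl⟩
      exact hsub hw
    exact hle (mem_missing_of_shift hz)
  rw [← toShift_app, ha] at h1
  have h3 : y - z + z ∈ missing V ((iota i).obj T₀) (ptMap α '' U) := add_mem h1 h2
  rw [sub_add_cancel] at h3
  rwa [← hy]

/-- Induction on the generating degree; `N` dominates the bounds for the cokernels in all directions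
and the torsion bound of `V`. -/
theorem FinGen.exists_goodAt [IsNoetherianRing k] {V : Mod.{u} m k} (hV : FinGen V) :
    ∃ n : Cat m, GoodAt n V := by
  obtain ⟨d, hd⟩ := (finGen_iff.1 hV).1
  induction d generalizing V with
  | zero =>
    exact ⟨objOf fun _ => 0, (Good.of_subsingleton hd.subsingleton).goodAt _⟩
  | succ d ih =>
    have hD : ∀ i, ∃ n : Cat m, GoodAt n (cokernel (toShift i V)) := by
      intro i
      refine ih ((hV.shift i).of_surjective (cokernel.π (toShift i V)) (surjective_app_of_epi _))
        fun t => eq_top_iff.2 fun y _ => ?_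
      obtain ⟨y, rfl⟩ := surjective_app_of_epi (cokernel.π (toShift i V)) t y
      obtain ⟨_, ⟨a, rfl⟩, z, hz, rfl⟩ := Submodule.mem_sup.1 (hd.mem_shift y)
      rw [map_add, (cokernel_exact (toShift i V) t _).2 ⟨a, rfl⟩, zero_add]
      exact app_mem_spanOf _ hz
    choose n hn using hD
    obtain ⟨n', hn'⟩ := hV.exists_torsion_bound
    let N : Cat m := objOf fun j => size n' j + ∑ i, size (n i) j
    have h1 : ∀ i, n i ⟶ N := fun i => homOfLE fun j =>
      (Finset.single_le_sum (f := fun i => size (n i) j) (fun _ _ => Nat.zero_le _)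
        (Finset.mem_univ i)).trans (Nat.le_add_left _ _)
    have h2 : n' ⟶ N := homOfLE fun j => Nat.le_add_right _ _
    exact ⟨N, goodAt_of_cokernel (fun i => (hn i).mono (h1 i))
      fun T r t f x hx => hn' T (h2 ≫ r) t f x hx⟩

theorem FinGen.exists_good_multiShift [IsNoetherianRing k] {V : Mod.{u} m k} (hV : FinGen V) :
    ∃ n : Fin m → ℕ, Good (FIm.multiShift n V) := by
  obtain ⟨n, hn⟩ := hV.exists_goodAt
  obtain ⟨Θ, h1, h2, h3⟩ := exists_multiShift_functor (k := k) (fun i => size n i)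
  refine ⟨fun i => size n i, ?_⟩
  rw [h1]
  refine GoodAt.good (n := objOf fun _ => 0) (fun _ => rfl) (h3 V _ (hn.mono ?_))
  exact homOfLE fun i => by rw [h2]; exact Nat.le_add_left _ _

/-! ### The map from a module to its iterated shift -/

/-- The properties of the natural map from a module to an iterated shift: its kernel is torsion,
and its cokernel is generated in lower degrees. -/
structure IsShiftMap {V W : Mod.{u} m k} (θ : V ⟶ W) (d : ℕ) : Prop where
  torsion : ∀ t x, (θ.app t).hom x = 0 → IsTorsionElt V x
  mem : ∀ t y, y ∈ LinearMap.range (θ.app t).hom ⊔ spanOf W t fun s _ => deg s < d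
  genLT : GenLT W (d + 1)

theorem IsShiftMap.id {V : Mod.{u} m k} {d : ℕ} (hV : GenLT V (d + 1)) : IsShiftMap (𝟙 V) d where
  torsion t x hx := ⟨t, 𝟙 t, by rw [map_id_hom]; exact hx⟩
  mem t y := Submodule.mem_sup_left ⟨y, rfl⟩
  genLT := hV

theorem IsShiftMap.comp_toShift {V W : Mod.{u} m k} {θ : V ⟶ W} {d : ℕ} (h : IsShiftMap θ d)
    (i : Fin m) : IsShiftMap (θ ≫ toShift i W) d where
  torsion t x hx := by
    have hx' : (W.map ((piNat i).app t)).hom ((θ.app t).hom x) = 0 := hx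
    obtain ⟨r, g, hg⟩ := h.torsion _ _ ((app_map θ ((piNat i).app t) x).trans hx')
    exact ⟨r, (piNat i).app t ≫ g, by rw [map_comp_hom]; exact hg⟩
  mem t y := by
    obtain ⟨_, ⟨w, rfl⟩, z, hz, rfl⟩ := Submodule.mem_sup.1 (h.genLT.mem_shift y)
    obtain ⟨_, ⟨v, rfl⟩, z', hz', rfl⟩ := Submodule.mem_sup.1 (h.mem t w)
    rw [map_add, add_assoc]
    exact Submodule.add_mem_sup ⟨v, rfl⟩ (add_mem (app_mem_spanOf (toShift i W) hz') hz)
  genLT := h.genLT.shift i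

theorem exists_isShiftMap (V : Mod.{u} m k) (n : Fin m → ℕ) :
    ∃ θ : V ⟶ multiShift n V, ∀ d, GenLT V (d + 1) → IsShiftMap θ d :=
  multiShift_induction (P := fun W => ∃ θ : V ⟶ W, ∀ d, GenLT V (d + 1) → IsShiftMap θ d)
    (fun i _ ⟨_, h⟩ => ⟨_, fun d hd => (h d hd).comp_toShift i⟩) n
    ⟨𝟙 V, fun _ hV => IsShiftMap.id hV⟩

end shifts

section degrees

variable {m : ℕ} {k : Type u} [CommRing k]

/-! ### The generating degree -/

theorem GenLT.gd_le {V : Mod.{u} m k} {d : ℕ} (hV : GenLT V d) :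
    gd V ≤ (((d : ℝ) - 1 : ℝ) : EReal) := by
  refine sSup_le ?_
  rintro _ (rfl | ⟨s, ⟨n, hn, rfl⟩, rfl⟩)
  · have : (-1 : EReal) = ((-1 : ℝ) : EReal) := by simp
    rw [this, EReal.coe_le_coe_iff]
    have : (0 : ℝ) ≤ d := Nat.cast_nonneg d
    linarith
  · have hlt : deg n < d := by
      by_contra hle
      have htop : augSub V n = ⊤ := by
        rw [eq_top_iff, ← hV n]
        refine spanOf_le fun s g v hs => Submodule.subset_span ⟨s, g, v, ?_, rfl⟩
        rintro rfl
        exact hle hs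
      exact not_subsingleton (H0 V n) (Submodule.Quotient.subsingleton_iff.2 htop)
    change ((deg n : ℕ) : EReal) ≤ _
    rw [← EReal.coe_natCast, EReal.coe_le_coe_iff]
    have : ((deg n + 1 : ℕ) : ℝ) ≤ d := Nat.cast_le.2 hlt
    push_cast at this
    linarith

/-- The least `d` works: if H_0 vanished in degree d - 1, the generators there would come from lower
degrees. The shift by one reflects the strict inequality in `GenLT`. -/
theorem FinGen.exists_gd_eq {V : Mod.{u} m k} (hV : FinGen V) :
    ∃ d : ℕ, GenLT V d ∧ gd V = (((d : ℝ) - 1 : ℝ) : EReal) := by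
  classical
  have hex := (finGen_iff.1 hV).1
  refine ⟨Nat.find hex, Nat.find_spec hex, le_antisymm (Nat.find_spec hex).gd_le ?_⟩
  have hspec := Nat.find_spec hex
  rcases hd : Nat.find hex with _ | e
  · refine le_sSup (Or.inl ?_)
    simp
  · rw [hd] at hspec
    have hnot : ¬ GenLT V e := Nat.find_min hex (by omega)
    suffices h : ∃ n : Cat m, Nontrivial (H0 V n) ∧ deg n = e by
      refine le_sSup (Or.inr ⟨e, h, ?_⟩)
      have h1 : ((e + 1 : ℕ) : ℝ) - 1 = e := by
        push_cast
        ring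
      rw [h1]
      exact EReal.coe_natCast.symm
    by_contra hcon
    push Not at hcon
    refine hnot fun t => ?_
    rw [eq_top_iff, ← hspec t]
    refine spanOf_le fun s f v hs => ?_
    rcases Nat.lt_succ_iff_lt_or_eq.1 hs with hlt | heq
    · exact mem_spanOf f hlt v
    · have h1 : Subsingleton (H0 V s) := by
        by_contra h
        exact hcon s (not_subsingleton_iff_nontrivial.1 h) heq
      have h2 : augSub V s ≤ (spanOf V t fun s _ => deg s < e).comap (V.map f).hom := by
        refine Submodule.span_le.2 ?_
        rintro _ ⟨r, g, w, hr, rfl⟩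
        rw [SetLike.mem_coe, Submodule.mem_comap, ← map_comp_hom]
        refine mem_spanOf (g ≫ f) (heq ▸ deg_lt_of_not_surjective g fun hsur => hr ?_) w
        obtain ⟨g', _⟩ := exists_inverse_of_surjective g hsur
        exact eq_of_iso g g'
      rw [Submodule.Quotient.subsingleton_iff.1 h1] at h2
      exact h2 trivial

/-! ### Vanishing of torsion modules beyond the torsion degrees -/

/-- A morphism is a composite of one-point extensions and an isomorphism. Each extension in
direction i starts at size at least n_i > td_i, where K_i H vanishes. -/
theorem map_injective_of_td_le {H : Mod.{u} m k} {n : Fin m → ℕ}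
    (hn : ∀ i, td i H + 1 ≤ (n i : EReal)) {s q : Cat m} (hs : ∀ i, n i ≤ size s i) (h : s ⟶ q) :
    Function.Injective (H.map h).hom := by
  induction hc : deg q - deg s generalizing s with
  | zero =>
    obtain ⟨h', hh, _⟩ := exists_inverse_of_surjective h (surjective_of_deg_le h (by omega))
    refine Function.LeftInverse.injective (g := (H.map h').hom) fun x => ?_
    rw [← map_comp_hom, hh, map_id_hom]
  | succ c ih =>
    have hex : ∃ i, size s i < size q i := by
      by_contra hcon
      push Not at hcon
      have : deg q ≤ deg s := Finset.sum_le_sum fun i _ => hcon i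
      omega
    obtain ⟨i, hi⟩ := hex
    have hle : ∀ j, size ((iota i).obj s) j ≤ size q j := by
      intro j
      rw [size_iota]
      split_ifs with hj
      · subst hj
        omega
      · exact size_le_of_hom h j
    obtain ⟨h', rfl⟩ := exists_extension h ((piNat i).app s) hle
    have hdeg : deg ((iota i).obj s) = deg s + 1 := by
      unfold deg
      simp only [size_iota, Finset.sum_add_distrib, Finset.sum_ite_eq', Finset.mem_univ, if_true]
    have h1 : Function.Injective (H.map h').hom :=
      ih (fun j => (hs j).trans (size_le_of_hom ((piNat i).app s) j)) h' (by omega)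
    have h2 : Function.Injective (H.map ((piNat i).app s)).hom := by
      rw [← LinearMap.ker_eq_bot]
      by_contra hne
      have h3 : ((size s i : ℕ) : EReal) ≤ td i H := le_sSup (Or.inr ⟨_, ⟨s, hne, rfl⟩, rfl⟩)
      have h4 : ((size s i : ℕ) : EReal) + 1 ≤ (n i : EReal) := (add_le_add_left h3 1).trans (hn i)
      have h5 : ((size s i + 1 : ℕ) : EReal) ≤ ((n i : ℕ) : EReal) := by
        push_cast
        exact h4
      have h6 := EReal.natCast_le_iff.1 h5
      have := hs i
      omega
    intro x y hxy
    rw [map_comp_hom, map_comp_hom] at hxy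
    exact h2 (h1 hxy)

theorem IsTorsion.subsingleton_of_td_le {H : Mod.{u} m k} (hH : IsTorsion H) {n : Fin m → ℕ}
    (hn : ∀ i, td i H + 1 ≤ (n i : EReal)) {s : Cat m} (hs : ∀ i, n i ≤ size s i) :
    Subsingleton (H.obj s) := by
  have h0 : generated H {x | IsTorsionElt H x.2} s ≤ ⊥ := by
    refine Submodule.span_le.2 ?_
    rintro _ ⟨x, ⟨r, g, hg⟩, f, rfl⟩
    obtain ⟨q, h, h', hh⟩ := exists_amalgam f g
    refine (Submodule.mem_bot k).2 (map_injective_of_td_le hn hs h ?_)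
    rw [← map_comp_hom, hh, map_comp_hom, hg, map_zero, map_zero]
  rw [hH s] at h0
  exact (Submodule.subsingleton_iff k).1 (subsingleton_of_bot_eq_top (le_antisymm bot_le h0))

theorem isTorsion_of_forall {H : Mod.{u} m k} (h : ∀ t (x : H.obj t), IsTorsionElt H x) :
    IsTorsion H := by
  intro t
  refine eq_top_iff.2 fun x _ => Submodule.subset_span ⟨⟨t, x⟩, h t x, 𝟙 t, map_id_hom H x⟩

/-! ### Homology of complexes -/

theorem exists_of_subsingleton_homology (K : CochainComplex (Mod.{u} m k) ℕ) (p : ℕ) {t : Cat m}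
    (h : Subsingleton ((K.homology p).obj t)) (z : (K.X p).obj t)
    (hz : ((K.d p (p + 1)).app t).hom z = 0) :
    ∃ a, ((K.d ((ComplexShape.up ℕ).prev p) p).app t).hom a = z := by
  let ev := (evaluation (Cat m) (ModuleCat.{u} k)).obj t
  have h1 : IsZero ((K.sc p).map ev).homology :=
    (ModuleCat.isZero_of_subsingleton ((K.homology p).obj t)).of_iso ((K.sc p).mapHomologyIso ev)
  have h2 := (ShortComplex.moduleCat_exact_iff _).1 ((ShortComplex.exact_iff_isZero_homology _).2 h1)
  refine h2 z ?_
  have key : ∀ q, (ComplexShape.up ℕ).next p = q → ((K.d p q).app t).hom z = 0 →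
      ((K.d p ((ComplexShape.up ℕ).next p)).app t).hom z = 0 := by
    rintro _ rfl h
    exact h
  exact key _ (CochainComplex.next ℕ p) hz

/-- A class is torsion once some morphism turns its cycle into a boundary. Leaving `q` free covers
position 0, where every incoming differential is zero. -/
theorem isTorsion_homology (K : CochainComplex (Mod.{u} m k) ℕ) (p : ℕ)
    (h : ∀ t (z : (K.X p).obj t), ((K.d p (p + 1)).app t).hom z = 0 →
      ∃ (s : Cat m) (f : t ⟶ s) (q : ℕ) (a : (K.X q).obj s),
        ((K.d q p).app s).hom a = ((K.X p).map f).hom z) : IsTorsion (K.homology p) := by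
  refine isTorsion_of_forall fun t y => ?_
  obtain ⟨c, rfl⟩ := surjective_app_of_epi (K.homologyπ p) t y
  obtain ⟨s, f, q, a, ha⟩ := h t (((K.iCycles p).app t).hom c)
    (comp_app_eq_zero (K.iCycles_d p (p + 1)) c)
  refine ⟨s, f, ?_⟩
  have h1 : ((K.cycles p).map f).hom c = ((K.toCycles q p).app s).hom a := by
    apply injective_app_of_mono (K.iCycles p) s
    rw [app_map, ← ha, ← K.toCycles_i q p]
    rfl
  rw [← app_map, h1]
  exact comp_app_eq_zero (K.toCycles_comp_homologyπ q p) a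

theorem finGen_homology [IsNoetherianRing k] (K : CochainComplex (Mod.{u} m k) ℕ) (p : ℕ)
    (h : FinGen (K.X p)) : FinGen (K.homology p) :=
  (finGen_of_injective (K.iCycles p) (injective_app_of_mono _) h).of_surjective (K.homologyπ p)
    (surjective_app_of_epi _)

/-! ### Shifts of modules with a relative projective complex -/

theorem exists_lift {A B Z : Mod.{u} m k} (φ : A ⟶ B) (i : Z ⟶ B)
    (hi : ∀ t, Function.Injective (i.app t).hom)
    (h : ∀ t x, ∃ z, (i.app t).hom z = (φ.app t).hom x) :
    ∃ ψ : A ⟶ Z, ∀ t x, (i.app t).hom ((ψ.app t).hom x) = (φ.app t).hom x := by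
  let ψ : ∀ t, A.obj t →ₗ[k] Z.obj t := fun t =>
    (LinearEquiv.ofInjective (i.app t).hom (hi t)).symm.toLinearMap ∘ₗ
      (φ.app t).hom.codRestrict _ fun x => h t x
  have hψ : ∀ t x, (i.app t).hom (ψ t x) = (φ.app t).hom x := fun t x =>
    congrArg Subtype.val ((LinearEquiv.ofInjective (i.app t).hom (hi t)).apply_symm_apply
      ⟨(φ.app t).hom x, h t x⟩)
  refine ⟨{ app := fun t => ModuleCat.ofHom (ψ t), naturality := fun s t f => ?_ }, hψ⟩
  refine ModuleCat.hom_ext (LinearMap.ext fun x => hi t ?_)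
  change (i.app t).hom (ψ t ((A.map f).hom x)) = (i.app t).hom ((Z.map f).hom (ψ s x))
  rw [hψ, app_map, app_map, hψ]

/-- Descending induction on the position, with `c` bounding the number of remaining terms. After the
shift, cycles, term and next cycles form a short exact sequence, so `IsSES.good_left` applies. -/
theorem good_shift_cycles {V : Mod.{u} m k} {l : ℤ} {K : CochainComplex (Mod.{u} m k) ℕ}
    (hK : IsRelProjComplex V l K) (Θ : Cat m ⥤ Cat m)
    (hΘ : ∀ W : Mod.{u} m k, Good W → Good (Θ ⋙ W))
    (hH : ∀ p : ℕ, (p : ℤ) ≤ l + 1 → ∀ t, Subsingleton ((K.homology p).obj (Θ.obj t)))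
    (c p : ℕ) (hc : l + 1 ≤ p + c) :
    ∃ (Z : Mod.{u} m k) (i : Z ⟶ K.X (p + 1)), (∀ t, Function.Injective (i.app t).hom) ∧
      (∀ t x, (∃ a, (i.app t).hom a = x) ↔ ((K.d (p + 1) (p + 1 + 1)).app t).hom x = 0) ∧
      Good (Θ ⋙ Z) := by
  obtain ⟨Z, i, hi, hZ⟩ := exists_sub (K.X (p + 1))
    (fun t => LinearMap.ker ((K.d (p + 1) (p + 1 + 1)).app t).hom) (fun {s t} g x hx => by
      rw [Submodule.mem_comap, LinearMap.mem_ker, app_map, LinearMap.mem_ker.1 hx, map_zero])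
  refine ⟨Z, i, hi, hZ, ?_⟩
  induction c generalizing p Z with
  | zero =>
    have h0 := subsingleton_of_isZero (hK.isZero p (by push_cast at hc; omega))
    exact Good.of_subsingleton fun t => @Function.Injective.subsingleton _ _ _ (hi _) (h0 _)
  | succ c ih =>
    by_cases hp : l < p
    · have h0 := subsingleton_of_isZero (hK.isZero p hp)
      exact Good.of_subsingleton fun t => @Function.Injective.subsingleton _ _ _ (hi _) (h0 _)
    obtain ⟨Z', i', hi', hZ'⟩ := exists_sub (K.X (p + 1 + 1))
      (fun t => LinearMap.ker ((K.d (p + 1 + 1) (p + 1 + 1 + 1)).app t).hom)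
      (fun {s t} g x hx => by
        rw [Submodule.mem_comap, LinearMap.mem_ker, app_map, LinearMap.mem_ker.1 hx, map_zero])
    have hgood' := ih (p + 1) (by push_cast at hc ⊢; omega) Z' i' hi' hZ'
    obtain ⟨ψ, hψ⟩ := exists_lift (K.d (p + 1) (p + 1 + 1)) i' hi' fun t x =>
      (hZ' t _).2 (comp_app_eq_zero (K.d_comp_d _ _ _) x)
    have hses : IsSES (Functor.whiskerLeft Θ i) (Functor.whiskerLeft Θ ψ) := by
      refine ⟨fun t => hi _, fun t x => ?_, fun t z => ?_⟩
      · refine Iff.trans ?_ (hZ (Θ.obj t) x).symm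
        change (ψ.app (Θ.obj t)).hom x = 0 ↔ ((K.d (p + 1) (p + 1 + 1)).app (Θ.obj t)).hom x = 0
        rw [← hψ]
        exact ((injective_iff_map_eq_zero' _).1 (hi' (Θ.obj t)) _).symm
      · by_cases hp' : l < (p + 1 : ℕ)
        · have h0 := subsingleton_of_isZero (hK.isZero (p + 1) hp') (Θ.obj t)
          exact ⟨0, (hi' (Θ.obj t)) (Subsingleton.elim _ _)⟩
        · obtain ⟨a, ha⟩ := exists_of_subsingleton_homology K (p + 1 + 1)
            (hH _ (by push_cast at hp' ⊢; omega) t) ((i'.app (Θ.obj t)).hom z)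
            ((hZ' (Θ.obj t) _).1 ⟨z, rfl⟩)
          have key : ∀ q, q = p + 1 → (∃ a, ((K.d q (p + 1 + 1)).app (Θ.obj t)).hom a =
              (i'.app (Θ.obj t)).hom z) → ∃ a, (ψ.app (Θ.obj t)).hom a = z := by
            rintro _ rfl ⟨a, ha⟩
            exact ⟨a, hi' _ ((hψ _ a).trans ha)⟩
          exact key _ (CochainComplex.prev_nat_succ _) ⟨a, ha⟩
    exact hses.good_left (hΘ _ (hK.relProj p (not_lt.1 hp)).good) hgood'

/-- Once the homology at positions 0 and 1 vanishes, the shift of `V` is isomorphic to the shifted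
cycles at position 1. -/
theorem isRelProj_multiShift {V : Mod.{u} m k} (hV : FinGen V) {l : ℤ}
    {K : CochainComplex (Mod.{u} m k) ℕ} (hK : IsRelProjComplex V l K) (n : Fin m → ℕ)
    (hn : ∀ p : ℕ, (p : ℤ) ≤ l + 1 → ∀ i : Fin m, td i (K.homology p) + 1 ≤ (n i : EReal)) :
    IsRelProj (multiShift n V) := by
  obtain ⟨Θ, h1, h2, _⟩ := exists_multiShift_functor (k := k) n
  have hH : ∀ p : ℕ, (p : ℤ) ≤ l + 1 → ∀ t, Subsingleton ((K.homology p).obj (Θ.obj t)) :=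
    fun p hp t => (hK.homology_torsion p).subsingleton_of_td_le (hn p hp) fun i => by
      rw [h2]; exact Nat.le_add_left _ _
  obtain ⟨d, hd⟩ := (finGen_iff.1 hV).1
  refine Good.isRelProj ?_ (hd.multiShift n)
  rw [h1]
  obtain ⟨e⟩ := hK.start
  refine Good.of_iso (Functor.isoWhiskerLeft Θ e) ?_
  obtain ⟨Z, i, hi, hZ, hgood⟩ := good_shift_cycles hK Θ (fun W hW => h1 W ▸ hW.multiShift n) hH
    (l + 1).toNat 0 (by push_cast; omega)
  obtain ⟨ψ, hψ⟩ := exists_lift (K.d 0 1) i hi fun t x =>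
    (hZ t _).2 (comp_app_eq_zero (K.d_comp_d _ _ _) x)
  have hbij : ∀ t, Function.Bijective ((Functor.whiskerLeft Θ ψ).app t).hom := by
    refine fun t => ⟨(injective_iff_map_eq_zero _).2 fun x hx => ?_, fun z => ?_⟩
    · have h3 : ((K.d 0 1).app (Θ.obj t)).hom x = 0 := by
        rw [← hψ]
        exact (congrArg _ hx).trans (map_zero _)
      obtain ⟨a, ha⟩ := exists_of_subsingleton_homology K 0
        (hH 0 (by have := hK.neg_one_le; push_cast; omega) t) x h3
      rw [← ha, K.shape _ _ (by simp)]
      rfl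
    -- For l = -1 the term at position 1 is zero, and there is nothing to lift.
    · by_cases hp : l < (0 : ℕ)
      · have h0 := subsingleton_of_isZero (hK.isZero 0 hp) (Θ.obj t)
        exact ⟨0, (hi (Θ.obj t)) (Subsingleton.elim _ _)⟩
      · obtain ⟨a, ha⟩ := exists_of_subsingleton_homology K 1
          (hH _ (by push_cast at hp ⊢; omega) t) ((i.app (Θ.obj t)).hom z)
          ((hZ (Θ.obj t) _).1 ⟨z, rfl⟩)
        have key : ∀ q, q = 0 → (∃ a, ((K.d q 1).app (Θ.obj t)).hom a =
            (i.app (Θ.obj t)).hom z) → ∃ a, (ψ.app (Θ.obj t)).hom a = z := by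
          rintro _ rfl ⟨a, ha⟩
          exact ⟨a, hi _ ((hψ _ a).trans ha)⟩
        exact key _ (CochainComplex.prev_nat_succ _) ⟨a, ha⟩
  have hiso := isIso_of_bijective _ hbij
  exact hgood.of_iso (asIso (Functor.whiskerLeft Θ ψ)).symm

end degrees

section resolution

variable {m : ℕ} {k : Type u} [CommRing k]

/-! ### The complex of relative projective modules -/

/-- A homomorphism from a finitely generated module to a relative projective module, with torsion
kernel and with a cokernel that is generated in lower degrees. -/
structure IsRelProjHull {W F : Mod.{u} m k} (θ : W ⟶ F) : Prop where
  finGen : FinGen F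
  good : Good F
  genLT : ∀ d, GenLT W d → GenLT F d
  isShiftMap : ∀ d, GenLT W (d + 1) → IsShiftMap θ d

/-- Finite generation is required only for the properties, so that a hull can be chosen for every
`W`; the identity is a placeholder in the other case. -/
theorem exists_isRelProjHull [IsNoetherianRing k] (W : Mod.{u} m k) :
    ∃ (F : Mod.{u} m k) (θ : W ⟶ F), FinGen W → IsRelProjHull θ := by
  by_cases hW : FinGen W
  · obtain ⟨n, hn⟩ := hW.exists_good_multiShift
    obtain ⟨θ, hθ⟩ := exists_isShiftMap W n
    exact ⟨_, θ, fun _ => ⟨hW.multiShift n, hn, fun _ hd => hd.multiShift n, hθ⟩⟩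
  · exact ⟨W, 𝟙 W, fun h => absurd h hW⟩

theorem IsRelProjHull.isTorsionElt {W F : Mod.{u} m k} {θ : W ⟶ F} (h : IsRelProjHull θ)
    (hW : FinGen W) {t : Cat m} (x : W.obj t) (hx : (θ.app t).hom x = 0) : IsTorsionElt W x := by
  obtain ⟨d, hd⟩ := (finGen_iff.1 hW).1
  exact (h.isShiftMap d (hd.mono d.le_succ)).torsion t x hx

theorem IsRelProjHull.genLT_of_cokernel {W F C : Mod.{u} m k} {θ : W ⟶ F} (h : IsRelProjHull θ)
    (p : F ⟶ C) (hp : ∀ t, Function.Surjective (p.app t).hom)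
    (hθp : ∀ t x, (p.app t).hom ((θ.app t).hom x) = 0) {d : ℕ} (hW : GenLT W d) :
    GenLT C (d - 1) := by
  rcases d with _ | d
  · exact (h.genLT 0 hW).of_surjective p hp
  · refine fun t => eq_top_iff.2 fun y _ => ?_
    obtain ⟨y, rfl⟩ := hp t y
    obtain ⟨_, ⟨x, rfl⟩, z, hz, rfl⟩ := Submodule.mem_sup.1 ((h.isShiftMap d hW).mem t y)
    rw [map_add, hθp, zero_add]
    exact app_mem_spanOf p hz

/-- A homomorphism of modules: a term of the complex together with the map to the cokernel of the
incoming differential. -/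
structure Stage (m : ℕ) (k : Type u) [CommRing k] where
  /-- The term of the complex. -/
  term : Mod.{u} m k
  /-- The cokernel of the incoming differential. -/
  coker : Mod.{u} m k
  /-- The quotient map. -/
  proj : term ⟶ coker

variable [IsNoetherianRing k]

/-- A relative projective module that receives a map from `W` with torsion kernel. -/
def hull (W : Mod.{u} m k) : Mod.{u} m k := (exists_isRelProjHull W).choose

/-- The map from `W` to its relative projective hull. -/
def toHull (W : Mod.{u} m k) : W ⟶ hull W := (exists_isRelProjHull W).choose_spec.choose

theorem isRelProjHull_toHull {W : Mod.{u} m k} (hW : FinGen W) : IsRelProjHull (toHull W) :=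
  (exists_isRelProjHull W).choose_spec.choose_spec hW

/-- The terms of the complex that starts with `V` and continues by embedding the cokernel of each
differential, up to torsion, into a relative projective module. -/
def stage (V : Mod.{u} m k) : ℕ → Stage.{u} m k
  | 0 => ⟨V, V, 𝟙 V⟩
  | p + 1 => ⟨hull (stage V p).coker, cokernel ((stage V p).proj ≫ toHull (stage V p).coker),
      cokernel.π _⟩

/-- The differentials of the complex. -/
def stageD (V : Mod.{u} m k) (p : ℕ) : (stage V p).term ⟶ (stage V (p + 1)).term :=
  (stage V p).proj ≫ toHull (stage V p).coker

theorem stageD_proj (V : Mod.{u} m k) (p : ℕ) : stageD V p ≫ (stage V (p + 1)).proj = 0 :=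
  cokernel.condition _

/-- The complex that starts with `V` and continues by embedding the cokernel of each differential,
up to torsion, into a relative projective module. -/
def hullComplex (V : Mod.{u} m k) : CochainComplex (Mod.{u} m k) ℕ :=
  CochainComplex.of (fun p => (stage V p).term) (stageD V) fun p =>
    (Category.assoc (stageD V p) (stage V (p + 1)).proj (toHull _)).symm.trans
      ((congrArg (· ≫ toHull _) (stageD_proj V p)).trans zero_comp)

theorem hullComplex_d (V : Mod.{u} m k) (p : ℕ) :
    (hullComplex V).d p (p + 1) = stageD V p :=
  CochainComplex.of_d (fun p => (stage V p).term) (stageD V) p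

theorem stage_proj_surjective (V : Mod.{u} m k) (p : ℕ) (t : Cat m) :
    Function.Surjective ((stage V p).proj.app t).hom := by
  cases p with
  | zero => exact fun x => ⟨x, rfl⟩
  | succ p => exact surjective_app_of_epi (cokernel.π _) t

theorem stage_finGen {V : Mod.{u} m k} (hV : FinGen V) (p : ℕ) :
    FinGen (stage V p).term ∧ FinGen (stage V p).coker := by
  induction p with
  | zero => exact ⟨hV, hV⟩
  | succ p ih =>
    have h := (isRelProjHull_toHull ih.2).finGen
    exact ⟨h, h.of_surjective (stage V (p + 1)).proj (stage_proj_surjective V (p + 1))⟩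

theorem stage_genLT {V : Mod.{u} m k} (hV : FinGen V) {d : ℕ} (hd : GenLT V d) (p : ℕ) :
    GenLT (stage V p).coker (d - p) := by
  induction p with
  | zero => exact hd
  | succ p ih =>
    refine (isRelProjHull_toHull (stage_finGen hV p).2).genLT_of_cokernel (stage V (p + 1)).proj
      (stage_proj_surjective V (p + 1)) (fun t x => ?_) ih
    obtain ⟨x, rfl⟩ := stage_proj_surjective V p t x
    exact comp_app_eq_zero (stageD_proj V p) x

theorem stage_succ_genLT {V : Mod.{u} m k} (hV : FinGen V) {d : ℕ} (hd : GenLT V d) (p : ℕ) :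
    GenLT (stage V (p + 1)).term (d - p) :=
  (isRelProjHull_toHull (stage_finGen hV p).2).genLT _ (stage_genLT hV hd p)

theorem hullComplex_isTorsion {V : Mod.{u} m k} (hV : FinGen V) (p : ℕ) :
    IsTorsion ((hullComplex V).homology p) := by
  refine isTorsion_homology _ p fun t z hz => ?_
  rw [hullComplex_d] at hz
  obtain ⟨s, f, hf⟩ := (isRelProjHull_toHull (stage_finGen hV p).2).isTorsionElt
    (stage_finGen hV p).2 (((stage V p).proj.app t).hom z) hz
  have hf' : ((stage V p).proj.app s).hom (((stage V p).term.map f).hom z) = 0 :=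
    (app_map _ f z).trans hf
  cases p with
  | zero => exact ⟨s, f, 0, 0, (map_zero _).trans hf'.symm⟩
  | succ p =>
    obtain ⟨a, ha⟩ := (cokernel_exact (stageD V p) s _).1 hf'
    refine ⟨s, f, p, a, ?_⟩
    rw [hullComplex_d]
    exact ha

theorem isRelProjComplex_hullComplex {V : Mod.{u} m k} (hV : FinGen V) :
    ∃ l : ℤ, IsRelProjComplex V l (hullComplex V) := by
  obtain ⟨D, hD, hgd⟩ := hV.exists_gd_eq
  -- Here D - 1 is the generating degree of `V`. The term F^j is generated in degrees below D - j,
  -- so it vanishes for j ≥ D.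
  refine ⟨(D : ℤ) - 1, ⟨Iso.refl V⟩, by omega, ?_, fun j hj => ?_, fun j hj => ?_, fun j hj => ?_,
    fun p => finGen_homology _ p (stage_finGen hV p).1, hullComplex_isTorsion hV⟩
  · rw [hgd]
    push_cast
    exact le_rfl
  · have h0 := stage_succ_genLT hV hD j
    rw [Nat.sub_eq_zero_of_le (by omega)] at h0
    exact (Functor.isZero_iff _).2 fun t =>
      have : Subsingleton (((hullComplex V).X (j + 1)).obj t) := h0.subsingleton t
      ModuleCat.isZero_of_subsingleton _
  · exact (isRelProjHull_toHull (stage_finGen hV j).2).good.isRelProj (stage_succ_genLT hV hD j)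
  · refine (stage_succ_genLT hV hD j).gd_le.trans ?_
    rw [hgd, ← EReal.coe_natCast, ← EReal.coe_sub, EReal.coe_le_coe_iff,
      Nat.cast_sub (by omega)]
    linarith

end resolution

end FIm

end

theorem theorem1p4 (m : ℕ) (hm : 0 < m) (k : Type u) [CommRing k] [IsNoetherianRing k]
    (V : FIm.Mod.{u} m k) (hV : FIm.FinGen V) :
    (∃ (l : ℤ) (K : CochainComplex (FIm.Mod.{u} m k) ℕ),
      FIm.IsRelProjComplex V l K ∧ ∀ p : ℕ, FIm.FinGen (K.X p)) ∧
    ∀ (l : ℤ) (K : CochainComplex (FIm.Mod.{u} m k) ℕ), FIm.IsRelProjComplex V l K →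
      ∀ n : Fin m → ℕ,
        (∀ p : ℕ, (p : ℤ) ≤ l + 1 → ∀ i : Fin m, FIm.td i (K.homology p) + 1 ≤ (n i : EReal)) →
        FIm.IsRelProj (FIm.multiShift n V) := by
  obtain ⟨l, hl⟩ := FIm.isRelProjComplex_hullComplex hV
  exact ⟨⟨l, _, hl, fun p => (FIm.stage_finGen hV p).1⟩,
    fun _ _ hK n hn => FIm.isRelProj_multiShift hV hK n hn⟩
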